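/- Let $\{\xi_k\}_{k\ge 0}$ be a stationary, centered, circularly symmetric complex Gaussian sequence with unit variance: the real and imaginary parts of the $\xi_k$ are jointly Gaussian, $\mathbb{E}\,\xi_k=0$, $\mathbb{E}[\xi_k\xi_l]=0$ and $\mathbb{E}[\xi_k\overline{\xi_l}]=\gamma(l-k)$ for all $k,l\ge 0$, where $\gamma:\mathbb{Z}\to\mathbb{C}$ and $\gamma(0)=1$. Let $f(z)=\sum_{k\ge 0}\xi_k z^k$, and let $f_{\mathrm{PV}}(z)=\sum_{k\ge 0}\zeta_k z^k$, where the $\zeta_k$ are i.i.d. standard complex Gaussian random variables; almost surely both series converge in the unit disk $\mathbb{D}=\{|z|<1\}$. For $g\in\{f,f_{\mathrm{PV}}\}$ and $D\subset\mathbb{D}$ let $N_g(D)$ be the number of zeros of $g$ in $D$, counted with multiplicity. A smooth domain is a nonempty connected open subset $D$ of $\mathbb{C}$ such that every $p\in\partial D$ has a neighbourhood $U$ and a $C^\infty$ function $\rho:\mathbb{C}\to\mathbb{R}$ with $d\rho(p)\ne 0$ and $D\cap U=\{\rho<0\}\cap U$. Then: 1. For every smooth domain $D\subset\mathbb{D}$,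 $\mathbb{E}N_f(D)\le \mathbb{E}N_{f_{\mathrm{PV}}}(D)$ (as elements of $[0,\infty]$). 2. The following are equivalent: (a) $\mathbb{E}N_f(D)=\mathbb{E}N_{f_{\mathrm{PV}}}(D)$ for some smooth domain $D$ with $\overline{D}\subset\mathbb{D}$; (b) $\mathbb{E}N_f(D)=\mathbb{E}N_{f_{\mathrm{PV}}}(D)$ for every smooth domain $D\subset\mathbb{D}$; (c) $f$ and $f_{\mathrm{PV}}$ have the same law as random functions on $\mathbb{D}$. -/

import Mathlib

open MeasureTheory ProbabilityTheory Metric Topology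
open scoped ENNReal NNReal ComplexConjugate

noncomputable section

/-- The random power series `f(z) = ∑ ξ_k z^k` with random coefficients `ξ_k`, `k ≥ 0`. -/
def randomPowerSeries {Ω : Type*} (ξ : ℕ → Ω → ℂ) (ω : Ω) (z : ℂ) : ℂ :=
  ∑' k : ℕ, ξ k ω * z ^ k

/-- The sequence `ξ` is a stationary, centered, unit-variance (circularly symmetric) complex
Gaussian process with covariance function `γ`, i.e. `E[ξ_k conj ξ_l] = γ (l - k)`, `γ 0 = 1`.
The law of a centered complex Gaussian process is determined by its covariance: its real and
imaginary parts are jointly Gaussian and its pseudo-covariances `E[ξ_k ξ_l]` vanish. -/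
structure IsStationaryComplexGaussian {Ω : Type*} [MeasurableSpace Ω] (P : Measure Ω)
    (γ : ℤ → ℂ) (ξ : ℕ → Ω → ℂ) : Prop where
  gaussian : IsGaussianProcess ξ P
  centered : ∀ k, ∫ ω, ξ k ω ∂P = 0
  circular : ∀ k l, ∫ ω, ξ k ω * ξ l ω ∂P = 0
  covariance : ∀ k l : ℕ, ∫ ω, ξ k ω * conj (ξ l ω) ∂P = γ ((l : ℤ) - (k : ℤ))
  unit_variance : γ 0 = 1

/-- The standard complex Gaussian law: the law of `X + iY` with `X`, `Y` independent real
centered Gaussians of variance `1/2`. -/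
def stdComplexGaussian : Measure ℂ :=
  ((gaussianReal 0 (1 / 2)).prod (gaussianReal 0 (1 / 2))).map
    (fun p : ℝ × ℝ => (p.1 : ℂ) + (p.2 : ℂ) * Complex.I)

/-- `ζ` is a sequence of i.i.d. standard complex Gaussian random variables. -/
structure IsIIDStdComplexGaussian {Ω : Type*} [MeasurableSpace Ω] (P : Measure Ω)
    (ζ : ℕ → Ω → ℂ) : Prop where
  hasLaw : ∀ k, HasLaw (ζ k) stdComplexGaussian P
  indep : iIndepFun ζ P

/-- The number of zeros of `f` in `D`, counted with multiplicity. -/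
def zeroCount (f : ℂ → ℂ) (D : Set ℂ) : ℝ≥0∞ :=
  ∑' z : D, ((analyticOrderAt f (z : ℂ) : ℕ∞) : ℝ≥0∞)

/-- The expected number of zeros in `D` of the random power series with coefficients `ξ`. -/
def expectedZeros {Ω : Type*} [MeasurableSpace Ω] (P : Measure Ω) (ξ : ℕ → Ω → ℂ)
    (D : Set ℂ) : ℝ≥0∞ :=
  ∫⁻ ω, zeroCount (randomPowerSeries ξ ω) D ∂P

/-- A domain (nonempty connected open set) in the plane with smooth boundary: near each boundary
point `p` it is the sublevel set `{ρ < 0}` of a smooth function `ρ` with `dρ(p) ≠ 0`. -/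
structure IsSmoothDomain (D : Set ℂ) : Prop where
  isOpen : IsOpen D
  isConnected : IsConnected D
  smooth_boundary : ∀ p ∈ frontier D, ∃ ρ : ℂ → ℝ, ContDiff ℝ (⊤ : ℕ∞) ρ ∧ fderiv ℝ ρ p ≠ 0 ∧
    ∀ᶠ z in 𝓝 p, (z ∈ D ↔ ρ z < 0)

/-- The random power series with coefficients `ξ` and `ζ` have the same law as random functions
on the open unit disk. The σ-algebra on functions is the one generated by point evaluations, which
on analytic functions is the Borel σ-algebra of locally uniform convergence. -/
def EqualInLaw {Ω Ω' : Type*} [MeasurableSpace Ω] [MeasurableSpace Ω'] (P : Measure Ω)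
    (P' : Measure Ω') (ξ : ℕ → Ω → ℂ) (ζ : ℕ → Ω' → ℂ) : Prop :=
  IdentDistrib (fun ω (z : ball (0 : ℂ) 1) => randomPowerSeries ξ ω z)
    (fun ω (z : ball (0 : ℂ) 1) => randomPowerSeries ζ ω z) P P'

end

/-! The variance of `f z` is `K z = Re H z / (1 - |z|²)`, where `H` (`herglotz`) is analytic on the
disk, has positive real part and satisfies `H 0 = 1`; white noise is the case `H = 1`. Since `f z`
is distributed as `√(K z)` times a standard Gaussian, `E log |f z|` equals `(1/2) log (K z)` up to
an additive constant, so the mean zero density is a multiple of `Δ log K`. Now `Re H` is harmonic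
and `log` is concave, so `log (Re H)` is superharmonic and the density can only drop below that of
white noise. If it does not drop on some open set, strict concavity forces `Re H` to be locally
constant, hence `H = 1`, and the coefficients of `H` return the white covariance.

The argument avoids Laplacians and densities. Jensen's formula (`jensenSum_eq`) writes a sum of
`log⁺ (R / |c - u|)` over zeros `u` as a circle average minus a central value; its expectation is
`jensenDensity K c R` (`IsGAF.lintegral_jensenSum`). The two kernels are compared at each disk by
Jensen's inequality on circles (`circleAverage_log_re_le`, `jensenDensity_covKernel`). Averaging
over centres `c` with `R → 0` recovers zero counts on any open set (`approxCount_le`,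
`zeroCount_le_liminf`), which gives part 1.

For equality, monotonicity on all open sets makes equality on `D` descend to disks inside `D` up to
an arbitrarily small loss of radius (`lintegral_zeroCount_ball_le`). A layer-cake discretisation in
the logarithm of the radius transfers this to Jensen densities
(`jensenDensity_le_of_lintegral_zeroCount_eq`), where equality in Jensen's inequality can be read
off. -/

noncomputable section

/-! ### Jensen's formula and zeros in the disk -/

/-- The sum of `log⁺ (R / |c - u|)` over the zeros `u` of `f` in the unit disk, counted with
multiplicity. -/
def jensenSum (f : ℂ → ℂ) (c : ℂ) (R : ℝ) : ℝ≥0∞ :=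
  ∑' u : ball (0 : ℂ) 1, ((analyticOrderAt f (u : ℂ) : ℕ∞) : ℝ≥0∞) *
    ENNReal.ofReal (Real.log (R * ‖c - u‖⁻¹))

/-- The total mass of `log⁺ (R / |x|)`. -/
def logMass (R : ℝ) : ℝ≥0∞ := ∫⁻ x : ℂ, ENNReal.ofReal (Real.log (R * ‖x‖⁻¹))

lemma analyticOrderAt_ne_top_of_ne_zero {f : ℂ → ℂ} (hf : AnalyticOnNhd ℂ f (ball 0 1))
    {c : ℂ} (hc : c ∈ ball (0 : ℂ) 1) (h0 : f c ≠ 0) {u : ℂ} (hu : u ∈ ball (0 : ℂ) 1) :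
    analyticOrderAt f u ≠ ⊤ := by
  refine hf.analyticOrderAt_ne_top_of_isPreconnected (convex_ball 0 1).isPreconnected hc hu ?_
  rw [(hf c hc).analyticOrderAt_eq_zero.mpr h0]
  simp

lemma AnalyticAt.divisor_eq_order {f : ℂ → ℂ} {s : Set ℂ} (hf : AnalyticOnNhd ℂ f s) {u : ℂ}
    (hu : u ∈ s) (h : analyticOrderAt f u ≠ ⊤) :
    ENNReal.ofReal (MeromorphicOn.divisor f s u : ℝ) = ((analyticOrderAt f u : ℕ∞) : ℝ≥0∞) ∧
      0 ≤ MeromorphicOn.divisor f s u := by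
  rw [MeromorphicOn.AnalyticOnNhd.divisor_apply hf hu]
  lift analyticOrderAt f u to ℕ using h with n
  simp

lemma log_mul_inv_norm_nonneg {R : ℝ} {c u : ℂ} (hu : u ∈ closedBall c R) :
    0 ≤ Real.log (R * ‖c - u‖⁻¹) := by
  rcases eq_or_ne c u with rfl | hne
  -- At `u = c` the conventions `0⁻¹ = 0` and `log 0 = 0` make the weight vanish rather than be
  -- infinite; hence the later assumptions `f c ≠ 0`.
  · simp
  · apply Real.log_nonneg
    rw [← div_eq_mul_inv, le_div_iff₀ (by simpa [sub_eq_zero] using hne)]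
    rw [mem_closedBall, dist_eq_norm, norm_sub_rev] at hu
    linarith

lemma ofReal_log_mul_inv_norm_eq_zero {R : ℝ} (hR : 0 < R) {c u : ℂ} (hu : u ∉ ball c R) :
    ENNReal.ofReal (Real.log (R * ‖c - u‖⁻¹)) = 0 := by
  rw [ENNReal.ofReal_eq_zero]
  rw [mem_ball, dist_eq_norm, norm_sub_rev, not_lt] at hu
  apply Real.log_nonpos (by positivity)
  rw [← div_eq_mul_inv]
  exact div_le_one_of_le₀ hu (by positivity)

/-- Jensen's formula, as an identity of extended nonnegative numbers. -/
lemma jensenSum_eq {f : ℂ → ℂ} (hf : AnalyticOnNhd ℂ f (ball 0 1)) {c : ℂ} {R : ℝ} (hR : 0 < R)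
    (hc : closedBall c R ⊆ ball 0 1) (h0 : f c ≠ 0) :
    jensenSum f c R =
        ENNReal.ofReal (Real.circleAverage (fun z => Real.log ‖f z‖) c R - Real.log ‖f c‖) ∧
      0 ≤ Real.circleAverage (fun z => Real.log ‖f z‖) c R - Real.log ‖f c‖ := by
  have hcb : c ∈ ball (0 : ℂ) 1 := hc (mem_closedBall_self hR.le)
  have hfc : AnalyticOnNhd ℂ f (closedBall c |R|) := by
    rw [abs_of_pos hR]; exact hf.mono hc
  have key := hfc.circleAverage_log_norm hR.ne' h0
  rw [key, add_sub_cancel_right]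
  rw [abs_of_pos hR] at hfc ⊢
  have hfin := (MeromorphicOn.divisor f (closedBall c R)).finiteSupport (isCompact_closedBall c R)
  have hnn : ∀ u, 0 ≤ (MeromorphicOn.divisor f (closedBall c R) u : ℝ) *
      Real.log (R * ‖c - u‖⁻¹) := by
    intro u
    by_cases hu : u ∈ closedBall c R
    · refine mul_nonneg ?_ (log_mul_inv_norm_nonneg hu)
      exact_mod_cast (AnalyticAt.divisor_eq_order hfc hu
        (analyticOrderAt_ne_top_of_ne_zero hf hcb h0 (hc hu))).2
    · simp [Function.locallyFinsuppWithin.apply_eq_zero_of_notMem _ hu]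
  refine ⟨?_, finsum_nonneg hnn⟩
  rw [finsum_eq_sum_of_support_subset (s := hfin.toFinset) _ (by
    intro u hu
    simp only [Function.mem_support, ne_eq, mul_eq_zero, not_or] at hu
    simpa using hu.1)]
  rw [ENNReal.ofReal_sum_of_nonneg (fun u _ => hnn u)]
  rw [jensenSum, tsum_subtype (ball (0 : ℂ) 1) (fun u : ℂ =>
    ((analyticOrderAt f (u : ℂ) : ℕ∞) : ℝ≥0∞) * ENNReal.ofReal (Real.log (R * ‖c - u‖⁻¹)))]
  have hterm : ∀ u, (ball (0 : ℂ) 1).indicator (fun u : ℂ =>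
      ((analyticOrderAt f (u : ℂ) : ℕ∞) : ℝ≥0∞) * ENNReal.ofReal (Real.log (R * ‖c - u‖⁻¹))) u =
      ENNReal.ofReal ((MeromorphicOn.divisor f (closedBall c R) u : ℝ) *
      Real.log (R * ‖c - u‖⁻¹)) := by
    intro u
    by_cases hu : u ∈ closedBall c R
    · have h := AnalyticAt.divisor_eq_order hfc hu
        (analyticOrderAt_ne_top_of_ne_zero hf hcb h0 (hc hu))
      rw [Set.indicator_of_mem (hc hu), ← h.1, ENNReal.ofReal_mul (by exact_mod_cast h.2)]
    · rw [Function.locallyFinsuppWithin.apply_eq_zero_of_notMem _ hu]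
      simp only [Int.cast_zero, zero_mul, ENNReal.ofReal_zero]
      by_cases hb : u ∈ ball (0 : ℂ) 1
      · rw [Set.indicator_of_mem hb,
          ofReal_log_mul_inv_norm_eq_zero hR (fun h => hu (ball_subset_closedBall h)), mul_zero]
      · rw [Set.indicator_of_notMem hb]
  simp_rw [hterm]
  refine tsum_eq_sum fun u hu => ?_
  have : MeromorphicOn.divisor f (closedBall c R) u = 0 := by simpa using hu
  simp [this]

/-- The divisor has finite support on each compact disk of an exhaustion. Countability allows sums
over zeros to be exchanged with integrals, and makes the zero set Lebesgue null. -/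
lemma countable_zeros {f : ℂ → ℂ} (hf : AnalyticOnNhd ℂ f (ball 0 1)) {c : ℂ}
    (hc : c ∈ ball (0 : ℂ) 1) (h0 : f c ≠ 0) : {u ∈ ball (0 : ℂ) 1 | f u = 0}.Countable := by
  have hsub : {u ∈ ball (0 : ℂ) 1 | f u = 0} ⊆ ⋃ n : ℕ,
      Function.support (MeromorphicOn.divisor f (closedBall 0 (1 - 1 / ((n : ℝ) + 1)))) := by
    rintro u ⟨hu, hfu⟩
    rw [mem_ball_zero_iff] at hu
    obtain ⟨n, hn⟩ := exists_nat_one_div_lt (sub_pos.mpr hu)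
    refine Set.mem_iUnion.mpr ⟨n, ?_⟩
    have hcb : closedBall (0 : ℂ) (1 - 1 / ((n : ℝ) + 1)) ⊆ ball 0 1 := by
      apply closedBall_subset_ball
      have : (0 : ℝ) < 1 / ((n : ℝ) + 1) := by positivity
      linarith
    have hub : u ∈ closedBall (0 : ℂ) (1 - 1 / ((n : ℝ) + 1)) := by
      rw [mem_closedBall_zero_iff]; linarith
    have ht := analyticOrderAt_ne_top_of_ne_zero hf hc h0 (hcb hub)
    rw [Function.mem_support]
    intro h
    have := (AnalyticAt.divisor_eq_order (hf.mono hcb) hub ht).1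
    rw [h] at this
    simp only [Int.cast_zero, ENNReal.ofReal_zero] at this
    have h2 : analyticOrderAt f u = 0 := by
      have := this.symm
      simpa using this
    exact ((hf u (hcb hub)).analyticOrderAt_eq_zero.mp h2) hfu
  refine Set.Countable.mono hsub (Set.countable_iUnion fun n => ?_)
  exact ((MeromorphicOn.divisor f _).finiteSupport (isCompact_closedBall _ _)).countable

/-! ### Averaging Jensen sums over the centre -/

lemma measurable_ofReal_log (R : ℝ) (u : ℂ) :
    Measurable fun c : ℂ => ENNReal.ofReal (Real.log (R * ‖c - u‖⁻¹)) := by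
  fun_prop

/-- Tonelli, after discarding non-zeros: the sum over the uncountable disk is really a sum over the
countable set `Z`. -/
lemma lintegral_jensenSum {f : ℂ → ℂ} (hf : AnalyticOnNhd ℂ f (ball 0 1)) {c₀ : ℂ}
    (hc : c₀ ∈ ball (0 : ℂ) 1) (h0 : f c₀ ≠ 0) (R : ℝ) (E : Set ℂ) :
    ∫⁻ c in E, jensenSum f c R = ∑' u : ball (0 : ℂ) 1,
      ((analyticOrderAt f (u : ℂ) : ℕ∞) : ℝ≥0∞) *
        ∫⁻ c in E, ENNReal.ofReal (Real.log (R * ‖c - u‖⁻¹)) := by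
  set Z := {u ∈ ball (0 : ℂ) 1 | f u = 0} with hZ
  have hZc : Z.Countable := countable_zeros hf hc h0
  have : Countable Z := hZc
  have hred : ∀ g : ℂ → ℝ≥0∞, ∑' u : ball (0 : ℂ) 1,
      ((analyticOrderAt f (u : ℂ) : ℕ∞) : ℝ≥0∞) * g u =
      ∑' u : Z, ((analyticOrderAt f (u : ℂ) : ℕ∞) : ℝ≥0∞) * g u := by
    intro g
    rw [tsum_subtype (ball (0 : ℂ) 1) (fun u => ((analyticOrderAt f u : ℕ∞) : ℝ≥0∞) * g u),
      tsum_subtype Z (fun u => ((analyticOrderAt f u : ℕ∞) : ℝ≥0∞) * g u)]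
    refine tsum_congr fun u => ?_
    by_cases hu : u ∈ ball (0 : ℂ) 1
    · by_cases hfu : f u = 0
      · rw [Set.indicator_of_mem hu, Set.indicator_of_mem (show u ∈ Z from ⟨hu, hfu⟩)]
      · rw [Set.indicator_of_mem hu, Set.indicator_of_notMem (fun h : u ∈ Z => hfu h.2),
          (hf u hu).analyticOrderAt_eq_zero.mpr hfu]
        simp
    · rw [Set.indicator_of_notMem hu, Set.indicator_of_notMem (fun h : u ∈ Z => hu h.1)]
  rw [hred (fun u => ∫⁻ c in E, ENNReal.ofReal (Real.log (R * ‖c - u‖⁻¹)))]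
  have : ∀ c, jensenSum f c R = ∑' u : Z, ((analyticOrderAt f (u : ℂ) : ℕ∞) : ℝ≥0∞) *
      ENNReal.ofReal (Real.log (R * ‖c - u‖⁻¹)) := fun c =>
    hred (fun u => ENNReal.ofReal (Real.log (R * ‖c - u‖⁻¹)))
  simp_rw [this]
  rw [lintegral_tsum (f := fun (u : Z) (c : ℂ) => ((analyticOrderAt f (u : ℂ) : ℕ∞) : ℝ≥0∞) *
    ENNReal.ofReal (Real.log (R * ‖c - u‖⁻¹)))
    (fun u => ((measurable_ofReal_log R u).const_mul _).aemeasurable)]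
  refine tsum_congr fun u => ?_
  rw [lintegral_const_mul _ (measurable_ofReal_log R u)]

lemma lintegral_log_eq_logMass (R : ℝ) (u : ℂ) :
    ∫⁻ c : ℂ, ENNReal.ofReal (Real.log (R * ‖c - u‖⁻¹)) = logMass R :=
  lintegral_sub_right_eq_self (fun x : ℂ => ENNReal.ofReal (Real.log (R * ‖x‖⁻¹))) u

lemma logMass_pos {R : ℝ} (hR : 0 < R) : logMass R ≠ 0 := by
  rw [logMass, ← pos_iff_ne_zero]
  refine (setLIntegral_pos_iff (s := ball 0 R \ {0}) (μ := volume)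
    (f := fun x : ℂ => ENNReal.ofReal (Real.log (R * ‖x‖⁻¹))) (by fun_prop)).mpr ?_
    |>.trans_le (setLIntegral_le_lintegral _ _)
  have hsub : ball (0 : ℂ) R \ {0} ⊆ Function.support
      (fun x : ℂ => ENNReal.ofReal (Real.log (R * ‖x‖⁻¹))) ∩ (ball 0 R \ {0}) := by
    rintro x ⟨hx, hx0⟩
    refine ⟨?_, hx, hx0⟩
    rw [mem_ball_zero_iff] at hx
    have hx0 : 0 < ‖x‖ := by simpa using hx0
    rw [Function.mem_support, ← pos_iff_ne_zero, ENNReal.ofReal_pos]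
    apply Real.log_pos
    rw [← div_eq_mul_inv, one_lt_div hx0]
    exact hx
  refine lt_of_lt_of_le ?_ (measure_mono hsub)
  rw [measure_sdiff_null (by simp)]
  exact measure_ball_pos _ _ hR

/-- In polar coordinates the Jacobian absorbs the singularity: `r log (R / r) ≤ R` for `0 < r < R`,
and the integrand vanishes beyond `R`. -/
lemma logMass_lt_top {R : ℝ} (hR : 0 < R) : logMass R ≠ ⊤ := by
  rw [logMass, ← Complex.lintegral_comp_polarCoord_symm]
  have hle : ∀ p : ℝ × ℝ, p ∈ polarCoord.target → ENNReal.ofReal p.1 •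
      ENNReal.ofReal (Real.log (R * ‖Complex.polarCoord.symm p‖⁻¹)) ≤
      (Set.Ioo 0 R ×ˢ Set.Ioo (-Real.pi) Real.pi).indicator (fun _ => ENNReal.ofReal R) p := by
    intro p hp
    rw [polarCoord_target] at hp
    have hp1 : 0 < p.1 := hp.1
    rw [Complex.norm_polarCoord_symm, abs_of_pos hp1]
    by_cases h : p.1 < R
    · rw [Set.indicator_of_mem (show p ∈ Set.Ioo 0 R ×ˢ Set.Ioo (-Real.pi) Real.pi from
        ⟨⟨hp1, h⟩, hp.2⟩), smul_eq_mul, ← ENNReal.ofReal_mul hp1.le]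
      apply ENNReal.ofReal_le_ofReal
      have := Real.log_le_self (show 0 ≤ R * p.1⁻¹ by positivity)
      calc p.1 * Real.log (R * p.1⁻¹) ≤ p.1 * (R * p.1⁻¹) := by gcongr
        _ = R := by field_simp
    · have : ENNReal.ofReal (Real.log (R * p.1⁻¹)) = 0 := by
        rw [ENNReal.ofReal_eq_zero]
        apply Real.log_nonpos (by positivity)
        rw [← div_eq_mul_inv]
        exact div_le_one_of_le₀ (not_lt.mp h) hp1.le
      simp [this]
  refine ne_top_of_le_ne_top ?_ (setLIntegral_mono' polarCoord.open_target.measurableSet hle)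
  refine ne_top_of_le_ne_top ?_ (setLIntegral_le_lintegral _ _)
  rw [lintegral_indicator_const (by measurability), Measure.volume_eq_prod, Measure.prod_prod]
  simp [ENNReal.mul_eq_top]

/-- A zero in `D` collects at most the full mass `logMass R`; a zero outside `D` is at distance at
least `R` from every centre in `E` and collects nothing. -/
lemma lintegral_jensenSum_le {f : ℂ → ℂ} (hf : AnalyticOnNhd ℂ f (ball 0 1)) {c₀ : ℂ}
    (hc : c₀ ∈ ball (0 : ℂ) 1) (h0 : f c₀ ≠ 0) {R : ℝ} (hR : 0 < R) {E D : Set ℂ}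
    (hE : MeasurableSet E) (hED : ∀ c ∈ E, ball c R ⊆ D) (hD : D ⊆ ball 0 1) :
    (logMass R)⁻¹ * ∫⁻ c in E, jensenSum f c R ≤ zeroCount f D := by
  rw [lintegral_jensenSum hf hc h0, zeroCount, ← ENNReal.tsum_mul_left,
    tsum_subtype (ball (0 : ℂ) 1) (fun u => (logMass R)⁻¹ *
      (((analyticOrderAt f u : ℕ∞) : ℝ≥0∞) *
        ∫⁻ c in E, ENNReal.ofReal (Real.log (R * ‖c - u‖⁻¹)))),
    tsum_subtype D (fun u => ((analyticOrderAt f u : ℕ∞) : ℝ≥0∞))]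
  refine ENNReal.tsum_le_tsum fun u => ?_
  by_cases hu : u ∈ D
  · rw [Set.indicator_of_mem (hD hu), Set.indicator_of_mem hu]
    calc _ ≤ (logMass R)⁻¹ * (((analyticOrderAt f u : ℕ∞) : ℝ≥0∞) * logMass R) := by
          gcongr
          rw [← lintegral_log_eq_logMass R u]
          exact setLIntegral_le_lintegral _ _
      _ = ((analyticOrderAt f u : ℕ∞) : ℝ≥0∞) := by
          rw [mul_left_comm, ENNReal.inv_mul_cancel (logMass_pos hR) (logMass_lt_top hR), mul_one]
  · rw [Set.indicator_of_notMem hu]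
    have hz : ∫⁻ c in E, ENNReal.ofReal (Real.log (R * ‖c - u‖⁻¹)) = 0 := by
      rw [← nonpos_iff_eq_zero, ← lintegral_zero (μ := volume.restrict E)]
      refine setLIntegral_mono' hE fun c hcE => ?_
      rw [ofReal_log_mul_inv_norm_eq_zero hR (fun h => hu (hED c hcE h))]
    by_cases hb : u ∈ ball (0 : ℂ) 1
    · rw [Set.indicator_of_mem hb, hz]; simp
    · rw [Set.indicator_of_notMem hb]

/-- The radii used to approximate zero counts by averaged Jensen sums. -/
def meshRadius (j : ℕ) : ℝ := 1 / ((j : ℝ) + 1)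

/-- The points of `D` further than `meshRadius j` from the complement of `D`. -/
def innerSet (D : Set ℂ) (j : ℕ) : Set ℂ := {c | meshRadius j < infDist c Dᶜ}

lemma meshRadius_pos (j : ℕ) : 0 < meshRadius j := by unfold meshRadius; positivity

lemma tendsto_meshRadius : Filter.Tendsto meshRadius Filter.atTop (𝓝 0) :=
  tendsto_one_div_add_atTop_nhds_zero_nat

lemma measurableSet_innerSet (D : Set ℂ) (j : ℕ) : MeasurableSet (innerSet D j) :=
  measurableSet_lt measurable_const (continuous_infDist_pt _).measurable

lemma closedBall_subset_of_mem_innerSet {D : Set ℂ} {j : ℕ} {c : ℂ} (hc : c ∈ innerSet D j) :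
    closedBall c (meshRadius j) ⊆ D := by
  intro x hx
  by_contra h
  have h1 := infDist_le_dist_of_mem (x := c) (show x ∈ Dᶜ from h)
  have h2 : meshRadius j < infDist c Dᶜ := hc
  rw [mem_closedBall, dist_comm] at hx
  linarith

lemma eventually_ball_subset_innerSet {D : Set ℂ} (hD : IsOpen D) (hD1 : D ⊆ ball 0 1) {u : ℂ}
    (hu : u ∈ D) : ∀ᶠ j in Filter.atTop, ball u (meshRadius j) ⊆ innerSet D j := by
  -- `infDist` to the empty set is `0`, so the complement has to be shown nonempty.
  have hne : (Dᶜ).Nonempty := ⟨1, fun h => by simpa using hD1 h⟩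
  have hpos : 0 < infDist u Dᶜ :=
    (hD.isClosed_compl.notMem_iff_infDist_pos hne).mp (fun h => h hu)
  filter_upwards [tendsto_meshRadius.eventually (gt_mem_nhds (half_pos hpos))] with j hj c hc
  have h1 := infDist_le_infDist_add_dist (s := Dᶜ) (x := u) (y := c)
  rw [mem_ball, dist_comm] at hc
  change meshRadius j < infDist c Dᶜ
  linarith

/-- For finitely many points of `D`, once `j` is large the disk of radius `meshRadius j` about each
lies in `innerSet D j`, so each point collects its full mass. Every finite partial sum is thus
eventually below the approximants. -/
lemma zeroCount_le_liminf {f : ℂ → ℂ} (hf : AnalyticOnNhd ℂ f (ball 0 1)) {c₀ : ℂ}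
    (hc : c₀ ∈ ball (0 : ℂ) 1) (h0 : f c₀ ≠ 0) {D : Set ℂ} (hD : IsOpen D)
    (hD1 : D ⊆ ball 0 1) :
    zeroCount f D ≤ Filter.liminf (fun j => (logMass (meshRadius j))⁻¹ *
      ∫⁻ c in innerSet D j, jensenSum f c (meshRadius j)) Filter.atTop := by
  rw [zeroCount, ENNReal.tsum_eq_iSup_sum]
  refine iSup_le fun s => ?_
  refine Filter.le_liminf_of_le (by isBoundedDefault) ?_
  have hev : ∀ᶠ j in Filter.atTop, ∀ u ∈ s, ball (u : ℂ) (meshRadius j) ⊆ innerSet D j :=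
    (Filter.eventually_all_finset s).mpr
      fun u _ => eventually_ball_subset_innerSet hD hD1 u.2
  filter_upwards [hev] with j hj
  rw [lintegral_jensenSum hf hc h0, ← ENNReal.tsum_mul_left]
  have hterm : ∀ u ∈ s, ((analyticOrderAt f (u : ℂ) : ℕ∞) : ℝ≥0∞) = (logMass (meshRadius j))⁻¹ *
      (((analyticOrderAt f (u : ℂ) : ℕ∞) : ℝ≥0∞) * ∫⁻ c in innerSet D j,
        ENNReal.ofReal (Real.log (meshRadius j * ‖c - u‖⁻¹))) := by
    intro u hu
    have : ∫⁻ c in innerSet D j, ENNReal.ofReal (Real.log (meshRadius j * ‖c - u‖⁻¹)) =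
        logMass (meshRadius j) := by
      rw [← lintegral_log_eq_logMass _ (u : ℂ),
        ← lintegral_indicator (measurableSet_innerSet D j)]
      refine lintegral_congr fun c => ?_
      by_cases hcE : c ∈ innerSet D j
      · rw [Set.indicator_of_mem hcE]
      · rw [Set.indicator_of_notMem hcE, ofReal_log_mul_inv_norm_eq_zero (meshRadius_pos j)]
        intro h
        exact hcE (hj u hu (mem_ball_comm.mp h))
    rw [this, mul_left_comm, ENNReal.inv_mul_cancel (logMass_pos (meshRadius_pos j))
      (logMass_lt_top (meshRadius_pos j)), mul_one]
  rw [Finset.sum_congr rfl hterm]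
  set g : ℂ → ℝ≥0∞ := fun u => (logMass (meshRadius j))⁻¹ *
      (((analyticOrderAt f (u : ℂ) : ℕ∞) : ℝ≥0∞) * ∫⁻ c in innerSet D j,
        ENNReal.ofReal (Real.log (meshRadius j * ‖c - u‖⁻¹)))
  calc ∑ u ∈ s, g u ≤ ∑' u : D, g u := ENNReal.sum_le_tsum s
    _ ≤ ∑' u : ball (0 : ℂ) 1, g u := ENNReal.tsum_mono_subtype g hD1

/-! ### The standard complex Gaussian law -/

lemma measurable_stdMap : Measurable (fun p : ℝ × ℝ => (p.1 : ℂ) + (p.2 : ℂ) * Complex.I) := by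
  fun_prop

instance : IsProbabilityMeasure stdComplexGaussian :=
  Measure.isProbabilityMeasure_map measurable_stdMap.aemeasurable

lemma stdComplexGaussian_integral_exp (w : ℂ) :
    ∫ z, Complex.exp (((w * z).re : ℂ) * Complex.I) ∂stdComplexGaussian =
      Complex.exp (-(1 / 4) * (w * conj w)) := by
  rw [stdComplexGaussian, integral_map measurable_stdMap.aemeasurable
    (by fun_prop)]
  have h : ∀ p : ℝ × ℝ, Complex.exp (((w * ((p.1 : ℂ) + (p.2 : ℂ) * Complex.I)).re : ℂ) *
      Complex.I) = Complex.exp ((w.re : ℂ) * p.1 * Complex.I) *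
      Complex.exp (((-w.im : ℝ) : ℂ) * p.2 * Complex.I) := by
    intro p
    rw [← Complex.exp_add]
    congr 1
    simp
    ring
  simp_rw [h]
  rw [integral_prod_mul (fun x : ℝ => Complex.exp ((w.re : ℂ) * x * Complex.I))
    (fun x : ℝ => Complex.exp (((-w.im : ℝ) : ℂ) * x * Complex.I)),
    ← charFun_apply_real, ← charFun_apply_real, charFun_gaussianReal, charFun_gaussianReal,
    ← Complex.exp_add, Complex.mul_conj, Complex.normSq_apply]
  congr 1
  push_cast
  ring

lemma stdComplexGaussian_zero : stdComplexGaussian {0} = 0 := by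
  rw [stdComplexGaussian, Measure.map_apply measurable_stdMap (measurableSet_singleton _)]
  have : (fun p : ℝ × ℝ => (p.1 : ℂ) + (p.2 : ℂ) * Complex.I) ⁻¹' {0} ⊆ {0} ×ˢ Set.univ := by
    rintro ⟨x, y⟩ h
    have h1 : (x : ℂ) + (y : ℂ) * Complex.I = 0 := h
    have := congrArg Complex.re h1
    simp at this
    simp [this]
  refine measure_mono_null this ?_
  have := nullSingletonClass_gaussianReal (μ := 0) (v := 1 / 2) (by norm_num)
  rw [Measure.prod_prod, measure_singleton, zero_mul]

lemma integrable_norm_stdComplexGaussian : Integrable (fun z : ℂ => ‖z‖) stdComplexGaussian := by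
  rw [stdComplexGaussian, integrable_map_measure (by fun_prop) measurable_stdMap.aemeasurable]
  have h : Integrable (fun x : ℝ => |x|) (gaussianReal 0 (1 / 2)) :=
    ((memLp_id_gaussianReal 1).integrable le_rfl).abs
  refine Integrable.mono' ((h.comp_fst (gaussianReal 0 (1 / 2))).add
    (h.comp_snd (gaussianReal 0 (1 / 2)))) (by fun_prop) (Filter.Eventually.of_forall fun p => ?_)
  simp only [Function.comp_apply, norm_norm, Pi.add_apply]
  refine (norm_add_le _ _).trans ?_
  simp

lemma gaussianReal_le_smul_volume {v : ℝ≥0} (hv : v ≠ 0) :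
    ∃ C : ℝ≥0∞, C ≠ ⊤ ∧ gaussianReal 0 v ≤ C • volume := by
  refine ⟨ENNReal.ofReal (√(2 * Real.pi * v))⁻¹, ENNReal.ofReal_ne_top, ?_⟩
  rw [gaussianReal_of_var_ne_zero 0 hv, ← withDensity_const]
  refine withDensity_mono (Filter.Eventually.of_forall fun x => ?_)
  rw [gaussianPDF]
  apply ENNReal.ofReal_le_ofReal
  rw [gaussianPDFReal]
  apply mul_le_of_le_one_right (by positivity)
  rw [Real.exp_le_one_iff]
  apply div_nonpos_of_nonpos_of_nonneg
  · nlinarith [sq_nonneg (x - 0)]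
  · positivity

/-- The Gaussian density is bounded, so local Lebesgue integrability of `log` carries over. -/
lemma integrable_indicator_log_gaussianReal {v : ℝ≥0} (hv : v ≠ 0) :
    Integrable ((Set.Ioc (-1 : ℝ) 1).indicator Real.log) (gaussianReal 0 v) := by
  obtain ⟨C, hC, hle⟩ := gaussianReal_le_smul_volume hv
  refine Integrable.mono_measure ?_ hle
  refine Integrable.smul_measure ?_ hC
  rw [integrable_indicator_iff measurableSet_Ioc]
  exact ((intervalIntegrable_iff_integrableOn_Ioc_of_le (by norm_num)).mp
    intervalIntegral.intervalIntegrable_log')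

/-- For `|z| ≥ 1` use `log |z| ≤ |z|`. For `|z| < 1` use `|Re z| ≤ |z|`, which bounds the
singularity by the one-dimensional `|log |Re z||`. -/
lemma integrable_log_norm_stdComplexGaussian :
    Integrable (fun z : ℂ => Real.log ‖z‖) stdComplexGaussian := by
  have hatom := nullSingletonClass_gaussianReal (μ := 0) (v := 1 / 2) (by norm_num)
  have h1 : Integrable (fun p : ℝ × ℝ => ‖(p.1 : ℂ) + (p.2 : ℂ) * Complex.I‖)
      ((gaussianReal 0 (1 / 2)).prod (gaussianReal 0 (1 / 2))) := by
    have := integrable_norm_stdComplexGaussian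
    rwa [stdComplexGaussian, integrable_map_measure (by fun_prop)
      measurable_stdMap.aemeasurable] at this
  have h2 := ((integrable_indicator_log_gaussianReal (v := 1 / 2) (by norm_num)).abs).comp_fst
    (gaussianReal 0 (1 / 2))
  rw [stdComplexGaussian, integrable_map_measure
    (show Measurable fun z : ℂ => Real.log ‖z‖ by fun_prop).aestronglyMeasurable
    measurable_stdMap.aemeasurable]
  refine Integrable.mono' (h1.add h2) ?_ ?_
  · have : Measurable fun p : ℝ × ℝ => Real.log ‖(p.1 : ℂ) + (p.2 : ℂ) * Complex.I‖ := by fun_prop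
    exact this.aestronglyMeasurable
  · have hne : ∀ᵐ x ∂(gaussianReal 0 (1 / 2)), x ≠ 0 := by
      rw [ae_iff]; simpa using measure_singleton (μ := gaussianReal 0 (1 / 2)) 0
    filter_upwards [Measure.quasiMeasurePreserving_fst.ae hne] with p hp
    simp only [Function.comp_apply, Pi.add_apply, Real.norm_eq_abs]
    set z : ℂ := (p.1 : ℂ) + (p.2 : ℂ) * Complex.I with hz
    have hx : |p.1| ≤ ‖z‖ := by
      have := Complex.abs_re_le_norm z
      simpa [hz] using this
    have hxpos : 0 < |p.1| := abs_pos.mpr hp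
    have hzpos : 0 < ‖z‖ := hxpos.trans_le hx
    rcases le_or_gt 1 ‖z‖ with h | h
    · rw [abs_of_nonneg (Real.log_nonneg h)]
      have := Real.log_le_self hzpos.le
      have := abs_nonneg ((Set.Ioc (-1 : ℝ) 1).indicator Real.log p.1)
      linarith
    · have hmem : p.1 ∈ Set.Ioc (-1 : ℝ) 1 := by
        have := abs_lt.mp (hx.trans_lt h)
        exact ⟨this.1, this.2.le⟩
      rw [Set.indicator_of_mem hmem, abs_of_nonpos (Real.log_nonpos hzpos.le h.le),
        ← Real.log_abs p.1, abs_of_nonpos (Real.log_nonpos hxpos.le (hx.trans h.le))]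
      have := Real.log_le_log hxpos hx
      linarith

/-! ### Circularly symmetric Gaussian coefficient sequences -/

/-- The variance `∑ w_k conj w_l γ (l - k)` of `∑_{k < n} w_k ξ_k`. -/
def covForm (γ : ℤ → ℂ) (n : ℕ) (w : ℕ → ℂ) : ℂ :=
  ∑ k ∈ Finset.range n, ∑ l ∈ Finset.range n, w k * conj (w l) * γ ((l : ℤ) - (k : ℤ))

/-- A normalized positive semidefinite stationary covariance function. -/
structure IsStationaryCov (γ : ℤ → ℂ) : Prop where
  zero : γ 0 = 1
  symm : ∀ n, γ (-n) = conj (γ n)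
  norm_le : ∀ n, ‖γ n‖ ≤ 1
  nonneg : ∀ n w, 0 ≤ (covForm γ n w).re

/-- The sequence `ξ` is circularly symmetric Gaussian with stationary covariance `γ`, expressed
through the characteristic functions of its finite linear combinations. -/
structure GaussianCoeffs {Ω : Type*} [MeasurableSpace Ω] (P : Measure Ω)
    (γ : ℤ → ℂ) (ξ : ℕ → Ω → ℂ) : Prop extends IsStationaryCov γ where
  aemeasurable : ∀ k, AEMeasurable (ξ k) P
  integral_exp : ∀ n (w : ℕ → ℂ), ∫ ω, Complex.exp
    (((∑ k ∈ Finset.range n, w k * ξ k ω).re : ℂ) * Complex.I) ∂P =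
      Complex.exp (-(1 / 4) * covForm γ n w)

section

variable {Ω : Type*} [MeasurableSpace Ω] {P : Measure Ω} {γ : ℤ → ℂ} {ξ : ℕ → Ω → ℂ}

namespace IsStationaryComplexGaussian

lemma memLp (h : IsStationaryComplexGaussian P γ ξ) (k : ℕ) : MemLp (ξ k) 2 P :=
  (h.gaussian.hasGaussianLaw_eval k).memLp_two

lemma integral_norm_sq (h : IsStationaryComplexGaussian P γ ξ) (k : ℕ) :
    ∫ ω, ‖ξ k ω‖ ^ 2 ∂P = 1 := by
  have := h.covariance k k
  rw [sub_self, h.unit_variance] at this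
  simp_rw [Complex.mul_conj, Complex.normSq_eq_norm_sq] at this
  rw [integral_complex_ofReal] at this
  exact_mod_cast this

lemma integral_mul_conj_sum (h : IsStationaryComplexGaussian P γ ξ) (n : ℕ) (w : ℕ → ℂ) :
    ∫ ω, (∑ k ∈ Finset.range n, w k * ξ k ω) * conj (∑ k ∈ Finset.range n, w k * ξ k ω) ∂P =
      covForm γ n w := by
  have hint : ∀ k l, Integrable (fun ω => w k * conj (w l) * (ξ k ω * conj (ξ l ω))) P :=
    fun k l => ((h.memLp k).integrable_mul (h.memLp l).star).const_mul _
  simp_rw [map_sum, map_mul, Finset.sum_mul_sum, fun k l ω =>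
    mul_mul_mul_comm (w k) (ξ k ω) (conj (w l)) (conj (ξ l ω))]
  rw [integral_finsetSum _ fun k _ => integrable_finsetSum _ fun l _ => hint k l, covForm]
  refine Finset.sum_congr rfl fun k _ => ?_
  rw [integral_finsetSum _ fun l _ => hint k l]
  refine Finset.sum_congr rfl fun l _ => ?_
  rw [integral_const_mul, h.covariance]

lemma integral_mul_sum (h : IsStationaryComplexGaussian P γ ξ) (n : ℕ) (w : ℕ → ℂ) :
    ∫ ω, (∑ k ∈ Finset.range n, w k * ξ k ω) * (∑ k ∈ Finset.range n, w k * ξ k ω) ∂P = 0 := by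
  have hint : ∀ k l, Integrable (fun ω => w k * w l * (ξ k ω * ξ l ω)) P :=
    fun k l => ((h.memLp k).integrable_mul (h.memLp l)).const_mul _
  simp_rw [Finset.sum_mul_sum, fun k l ω => mul_mul_mul_comm (w k) (ξ k ω) (w l) (ξ l ω)]
  rw [integral_finsetSum _ fun k _ => integrable_finsetSum _ fun l _ => hint k l]
  refine Finset.sum_eq_zero fun k _ => ?_
  rw [integral_finsetSum _ fun l _ => hint k l]
  refine Finset.sum_eq_zero fun l _ => ?_
  rw [integral_const_mul, h.circular, mul_zero]

lemma memLp_sum (h : IsStationaryComplexGaussian P γ ξ) (n : ℕ) (w : ℕ → ℂ) :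
    MemLp (fun ω => ∑ k ∈ Finset.range n, w k * ξ k ω) 2 P :=
  memLp_finsetSum _ fun k _ => (h.memLp k).const_mul (w k)

lemma covForm_eq_ofReal (h : IsStationaryComplexGaussian P γ ξ) (n : ℕ) (w : ℕ → ℂ) :
    covForm γ n w = ((∫ ω, ‖∑ k ∈ Finset.range n, w k * ξ k ω‖ ^ 2 ∂P : ℝ) : ℂ) := by
  rw [← h.integral_mul_conj_sum, ← integral_complex_ofReal]
  simp_rw [Complex.mul_conj, Complex.normSq_eq_norm_sq]

/-- Circular symmetry kills `E[S²]`, and `(Re S)² = (1/2) Re (|S|² + S²)`: the real part carries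
half of the variance. -/
lemma integral_re_sq (h : IsStationaryComplexGaussian P γ ξ) (n : ℕ) (w : ℕ → ℂ) :
    ∫ ω, (∑ k ∈ Finset.range n, w k * ξ k ω).re ^ 2 ∂P = (covForm γ n w).re / 2 := by
  set S : Ω → ℂ := fun ω => ∑ k ∈ Finset.range n, w k * ξ k ω with hS
  have hL : MemLp S 2 P := h.memLp_sum n w
  have h1 : Integrable (fun ω => S ω * conj (S ω)) P := hL.integrable_mul hL.star
  have h2 : Integrable (fun ω => S ω * S ω) P := hL.integrable_mul hL
  have hpt : ∀ ω, (S ω).re ^ 2 = (1 / 2) * (S ω * conj (S ω) + S ω * S ω).re := by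
    intro ω; simp; ring
  change ∫ ω, (S ω).re ^ 2 ∂P = _
  simp_rw [hpt]
  have h3 := integral_re (𝕜 := ℂ) (h1.add h2)
  simp only [RCLike.re_eq_complex_re, Pi.add_apply] at h3
  rw [integral_const_mul, h3, integral_add h1 h2, h.integral_mul_conj_sum n w,
    h.integral_mul_sum n w, add_zero]
  ring

lemma integral_re_sum (h : IsStationaryComplexGaussian P γ ξ) [IsProbabilityMeasure P]
    (n : ℕ) (w : ℕ → ℂ) :
    ∫ ω, (∑ k ∈ Finset.range n, w k * ξ k ω).re ∂P = 0 := by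
  have hint : ∀ k, Integrable (fun ω => w k * ξ k ω) P :=
    fun k => ((h.memLp k).integrable (by norm_num)).const_mul _
  have h3 := integral_re (𝕜 := ℂ) (integrable_finsetSum (Finset.range n) fun k _ => hint k)
  simp only [RCLike.re_eq_complex_re] at h3
  rw [h3, integral_finsetSum _ fun k _ => hint k]
  simp [integral_const_mul, h.centered]

lemma hasGaussianLaw_re_sum (h : IsStationaryComplexGaussian P γ ξ) (n : ℕ) (w : ℕ → ℂ) :
    HasGaussianLaw (fun ω => (∑ k ∈ Finset.range n, w k * ξ k ω).re) P := by
  have h1 := h.gaussian.comp_left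
    (fun k => ((ContinuousLinearMap.mul ℂ ℂ (w k)).restrictScalars ℝ))
  exact (h1.hasGaussianLaw_fun_sum (I := Finset.range n)).map_fun Complex.reCLM

/-- The real part of a linear combination is a centred real Gaussian of variance `covForm / 2`; its
characteristic function at `1` is the required exponential. -/
lemma gaussianCoeffs (h : IsStationaryComplexGaussian P γ ξ) [IsProbabilityMeasure P] :
    GaussianCoeffs P γ ξ where
  aemeasurable := h.gaussian.aemeasurable
  integral_exp n w := by
    set X : Ω → ℝ := fun ω => (∑ k ∈ Finset.range n, w k * ξ k ω).re with hX
    have hG := h.hasGaussianLaw_re_sum n w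
    have hmap := hG.map_eq_gaussianReal
    have hmean : P[X] = 0 := h.integral_re_sum n w
    have hvar : Var[X; P] = (covForm γ n w).re / 2 := by
      rw [variance_of_integral_eq_zero hG.aemeasurable hmean]
      exact h.integral_re_sq n w
    have hc : charFun (P.map X) 1 = ∫ ω, Complex.exp ((X ω : ℂ) * Complex.I) ∂P := by
      rw [charFun_apply_real, integral_map hG.aemeasurable (by fun_prop)]
      simp only [Complex.ofReal_one, one_mul, hX]
    change ∫ ω, Complex.exp ((X ω : ℂ) * Complex.I) ∂P = _
    have hre : covForm γ n w = ((covForm γ n w).re : ℂ) := by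
      rw [h.covForm_eq_ofReal n w, Complex.ofReal_re]
    have hnn : 0 ≤ (covForm γ n w).re := by
      rw [h.covForm_eq_ofReal n w, Complex.ofReal_re]
      positivity
    rw [← hc, hmap, charFun_gaussianReal, hmean, hvar, hre, Complex.ofReal_re]
    congr 1
    rw [Real.coe_toNNReal _ (by positivity)]
    push_cast
    ring
  zero := h.unit_variance
  symm n := by
    -- The covariance is given only at differences of naturals; taking one of the two indices to be
    -- `0` reaches every integer.
    have key : ∀ k l : ℕ, γ ((k : ℤ) - l) = conj (γ ((l : ℤ) - k)) := by
      intro k l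
      rw [← h.covariance l k, ← h.covariance k l, ← integral_conj]
      simp [mul_comm]
    rcases le_total 0 n with hn | hn
    · lift n to ℕ using hn
      simpa using key 0 n
    · obtain ⟨m, rfl⟩ := Int.exists_eq_neg_ofNat hn
      simpa using key m 0
  norm_le n := by
    have key : ∀ k l : ℕ, ‖γ ((l : ℤ) - k)‖ ≤ 1 := by
      intro k l
      rw [← h.covariance k l]
      have hk := (h.memLp k).integrable_norm_pow (by norm_num)
      have hl := (h.memLp l).integrable_norm_pow (by norm_num)
      calc ‖∫ ω, ξ k ω * conj (ξ l ω) ∂P‖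
          ≤ ∫ ω, (1 / 2) * (‖ξ k ω‖ ^ 2 + ‖ξ l ω‖ ^ 2) ∂P := by
            refine norm_integral_le_of_norm_le ((hk.add hl).const_mul _)
              (Filter.Eventually.of_forall fun ω => ?_)
            simp only [norm_mul, RCLike.norm_conj]
            nlinarith [sq_nonneg (‖ξ k ω‖ - ‖ξ l ω‖)]
        _ = 1 := by
            rw [integral_const_mul, integral_add hk hl, h.integral_norm_sq, h.integral_norm_sq]
            norm_num
    rcases le_total 0 n with hn | hn
    · lift n to ℕ using hn
      simpa using key 0 n
    · obtain ⟨m, rfl⟩ := Int.exists_eq_neg_ofNat hn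
      simpa using key m 0
  nonneg n w := by
    rw [h.covForm_eq_ofReal n w, Complex.ofReal_re]
    positivity

end IsStationaryComplexGaussian

/-! ### White noise -/

/-- The covariance function of white noise. -/
def whiteCov (n : ℤ) : ℂ := if n = 0 then 1 else 0

lemma covForm_whiteCov (n : ℕ) (w : ℕ → ℂ) :
    covForm whiteCov n w = ∑ k ∈ Finset.range n, w k * conj (w k) := by
  refine Finset.sum_congr rfl fun k hk => ?_
  rw [Finset.sum_eq_single k]
  · simp [whiteCov]
  · intro l _ hlk
    rw [whiteCov, if_neg (by omega), mul_zero]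
  · intro h; exact absurd hk h

lemma isStationaryCov_whiteCov : IsStationaryCov whiteCov where
  zero := by simp [whiteCov]
  symm n := by unfold whiteCov; split_ifs <;> simp_all
  norm_le n := by unfold whiteCov; split_ifs <;> simp
  nonneg n w := by
    rw [covForm_whiteCov, Complex.re_sum]
    refine Finset.sum_nonneg fun k _ => ?_
    rw [Complex.mul_conj, Complex.ofReal_re]
    exact Complex.normSq_nonneg _

lemma IsIIDStdComplexGaussian.gaussianCoeffs [IsProbabilityMeasure P]
    (h : IsIIDStdComplexGaussian P ξ) : GaussianCoeffs P whiteCov ξ where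
  toIsStationaryCov := isStationaryCov_whiteCov
  aemeasurable k := (h.hasLaw k).aemeasurable
  integral_exp n w := by
    have hind : iIndepFun (fun (k : Finset.range n) => ξ k) P :=
      h.indep.precomp Subtype.val_injective
    have hprod : ∀ ω, Complex.exp
        (((∑ k ∈ Finset.range n, w k * ξ k ω).re : ℂ) * Complex.I) =
        ∏ k : Finset.range n, Complex.exp (((w k * ξ k ω).re : ℂ) * Complex.I) := by
      intro ω
      rw [← Complex.exp_sum, ← Finset.sum_mul, Complex.re_sum, ← Finset.sum_coe_sort]
      simp
    simp_rw [hprod]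
    rw [hind.integral_fun_prod_comp (f := fun (k : Finset.range n) (z : ℂ) =>
      Complex.exp (((w k * z).re : ℂ) * Complex.I))
      (fun k => (h.hasLaw k).aemeasurable) (fun k => by fun_prop)]
    have : ∀ k : Finset.range n, ∫ ω, Complex.exp (((w k * ξ k ω).re : ℂ) * Complex.I) ∂P =
        Complex.exp (-(1 / 4) * (w k * conj (w k))) := by
      intro k
      rw [← stdComplexGaussian_integral_exp, ← (h.hasLaw k).map_eq,
        integral_map (h.hasLaw k).aemeasurable (by fun_prop)]
    simp_rw [this]
    rw [← Complex.exp_sum, covForm_whiteCov, ← Finset.mul_sum,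
      ← Finset.sum_coe_sort (Finset.range n)]

end

/-! ### Power series with subexponential coefficients -/

lemma analyticOnNhd_tsum_pow {a : ℕ → ℂ}
    (h : ∀ r : ℝ, 0 ≤ r → r < 1 → Summable fun k => ‖a k‖ * r ^ k) :
    AnalyticOnNhd ℂ (fun z => ∑' k, a k * z ^ k) (ball 0 1) := by
  intro z hz
  rw [mem_ball_zero_iff] at hz
  obtain ⟨r, hzr, hr1⟩ := exists_between hz
  have hr0 : 0 ≤ r := (norm_nonneg z).trans hzr.le
  have hd : DifferentiableOn ℂ (fun z => ∑' k, a k * z ^ k) (ball 0 r) := by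
    refine Complex.differentiableOn_tsum_of_summable_norm (h r hr0 hr1) (fun i => by fun_prop)
      isOpen_ball fun i w hw => ?_
    rw [norm_mul, norm_pow]
    rw [mem_ball_zero_iff] at hw
    gcongr
  exact hd.analyticOnNhd isOpen_ball z (by rwa [mem_ball_zero_iff])

/-- Uniqueness of power series expansions; this later turns `H = 1` into the vanishing of the
covariance off zero. -/
lemma coeff_eq_zero_of_tsum_eq_const {a : ℕ → ℂ}
    (h : ∀ r : ℝ, 0 ≤ r → r < 1 → Summable fun k => ‖a k‖ * r ^ k) {C : ℂ}
    (hC : ∀ z ∈ ball (0 : ℂ) 1, ∑' k, a k * z ^ k = C) {n : ℕ} (hn : n ≠ 0) : a n = 0 := by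
  have hp : HasFPowerSeriesAt (fun z => ∑' k, a k * z ^ k)
      (FormalMultilinearSeries.ofScalars ℂ a) 0 := by
    refine ⟨1 / 2, ?_, by norm_num, ?_⟩
    · have : Summable fun k => ‖FormalMultilinearSeries.ofScalars ℂ a k‖ *
          ((1 / 2 : ℝ≥0) : ℝ) ^ k := by
        simp_rw [FormalMultilinearSeries.ofScalars_norm]
        exact h _ (by positivity) (by push_cast; norm_num)
      have := FormalMultilinearSeries.le_radius_of_summable _ this
      simpa using this
    · intro y hy
      have hy' : ‖y‖ < 1 := by
        have h1 : ‖y‖ₑ < 1 / 2 := by simpa using hy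
        have h2 : ‖y‖ₑ < 1 := h1.trans_le (by norm_num)
        rw [← ofReal_norm, ← ENNReal.ofReal_one] at h2
        exact (ENNReal.ofReal_lt_ofReal_iff one_pos).mp h2
      have hs : Summable fun k => a k * y ^ k := by
        refine Summable.of_norm ?_
        simp_rw [norm_mul, norm_pow]
        exact h _ (norm_nonneg _) hy'
      simpa [FormalMultilinearSeries.ofScalars_apply_eq, smul_eq_mul, mul_comm] using hs.hasSum
  have hc : HasFPowerSeriesAt (fun z => ∑' k, a k * z ^ k)
      (constFormalMultilinearSeries ℂ ℂ C) 0 := by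
    refine hasFPowerSeriesAt_const.congr ?_
    filter_upwards [ball_mem_nhds (0 : ℂ) one_pos] with z hz
    exact (hC z hz).symm
  have := congrArg (fun p => FormalMultilinearSeries.coeff p n) (hp.eq_formalMultilinearSeries hc)
  simp only [FormalMultilinearSeries.coeff_ofScalars] at this
  rw [this, FormalMultilinearSeries.coeff, constFormalMultilinearSeries_apply_of_nonzero hn]
  simp

/-! ### The covariance kernel -/

/-- The power series coefficients of the function whose real part is the Poisson extension of the
spectral measure of `γ`. -/
def herglotzCoeff (γ : ℤ → ℂ) (n : ℕ) : ℂ := if n = 0 then 1 else 2 * γ (-(n : ℤ))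

/-- The analytic function with positive real part attached to the covariance `γ`. -/
def herglotz (γ : ℤ → ℂ) (z : ℂ) : ℂ := ∑' n, herglotzCoeff γ n * z ^ n

/-- The variance of the random power series with covariance `γ` at `z`. -/
def covKernel (γ : ℤ → ℂ) (z : ℂ) : ℝ := (herglotz γ z).re / (1 - ‖z‖ ^ 2)

/-- The row and column of index `0` are split off; by stationarity the remaining block is the
previous form times `|z|²`. In the limit this is a linear fixed-point equation for the variance. -/
lemma covForm_succ {γ : ℤ → ℂ} (h0 : γ 0 = 1) (n : ℕ) (z : ℂ) :
    covForm γ (n + 1) (fun k => z ^ k) =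
      1 + ∑ k ∈ Finset.range n, z ^ (k + 1) * γ (-((k + 1 : ℕ) : ℤ)) +
        ∑ l ∈ Finset.range n, conj z ^ (l + 1) * γ ((l + 1 : ℕ) : ℤ) +
        z * conj z * covForm γ n (fun k => z ^ k) := by
  rw [covForm, Finset.sum_range_succ']
  simp_rw [Finset.sum_range_succ' _ n]
  rw [Finset.sum_add_distrib, covForm, Finset.mul_sum]
  simp only [Nat.cast_zero, zero_sub, sub_zero, pow_zero, map_one, mul_one, one_mul, h0, map_pow,
    sub_self]
  have h1 : ∀ k l : ℕ, z ^ (k + 1) * conj z ^ (l + 1) *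
      γ (((l + 1 : ℕ) : ℤ) - ((k + 1 : ℕ) : ℤ)) =
      z * conj z * (z ^ k * conj z ^ l * γ ((l : ℤ) - k)) := by
    intro k l
    rw [show ((l + 1 : ℕ) : ℤ) - ((k + 1 : ℕ) : ℤ) = (l : ℤ) - k by push_cast; ring]
    ring
  simp_rw [h1, ← Finset.mul_sum]
  ring

namespace IsStationaryCov

variable {γ : ℤ → ℂ}

lemma summable_herglotz (h : IsStationaryCov γ) (r : ℝ) (h0 : 0 ≤ r) (h1 : r < 1) :
    Summable fun k => ‖herglotzCoeff γ k‖ * r ^ k := by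
  refine Summable.of_nonneg_of_le (fun k => by positivity) (fun k => ?_)
    ((summable_geometric_of_lt_one h0 h1).mul_left 2)
  gcongr
  unfold herglotzCoeff
  split_ifs
  · simp
  · rw [norm_mul]
    have := h.norm_le (-(k : ℤ))
    simp only [Complex.norm_ofNat]
    linarith

lemma analyticOnNhd_herglotz (h : IsStationaryCov γ) : AnalyticOnNhd ℂ (herglotz γ) (ball 0 1) :=
  analyticOnNhd_tsum_pow h.summable_herglotz

lemma tendsto_herglotz (h : IsStationaryCov γ) {z : ℂ} (hz : ‖z‖ < 1) :
    Filter.Tendsto (fun n => 1 + 2 * ∑ k ∈ Finset.range n, z ^ (k + 1) * γ (-((k + 1 : ℕ) : ℤ)))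
      Filter.atTop (𝓝 (herglotz γ z)) := by
  have hs : Summable fun k => herglotzCoeff γ k * z ^ k := by
    refine Summable.of_norm ?_
    simp_rw [norm_mul, norm_pow]
    exact h.summable_herglotz _ (norm_nonneg _) hz
  have := (Filter.tendsto_add_atTop_iff_nat 1).mpr hs.hasSum.tendsto_sum_nat
  refine this.congr fun n => ?_
  rw [Finset.sum_range_succ', add_comm]
  simp only [herglotzCoeff, pow_zero, if_true, mul_one, Nat.add_eq_zero_iff, one_ne_zero,
    and_false, if_false, Finset.mul_sum]
  congr 1
  refine Finset.sum_congr rfl fun k _ => ?_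
  ring

/-- Since `|γ| ≤ 1`, the double series is dominated by a product of geometric series. Existence of
the limit is needed before the recursion can be solved for it. -/
lemma exists_tendsto_covForm (h : IsStationaryCov γ) {z : ℂ} (hz : ‖z‖ < 1) :
    ∃ B, Filter.Tendsto (fun n => covForm γ n (fun k => z ^ k)) Filter.atTop (𝓝 B) := by
  have hs : Summable fun p : ℕ × ℕ =>
      z ^ p.1 * conj (z ^ p.2) * γ ((p.2 : ℤ) - (p.1 : ℤ)) := by
    have hg := summable_geometric_of_lt_one (norm_nonneg z) hz
    refine Summable.of_norm_bounded (g := fun p : ℕ × ℕ => ‖z‖ ^ p.1 * ‖z‖ ^ p.2)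
      (hg.mul_of_nonneg hg (fun _ => by positivity) (fun _ => by positivity)) fun p => ?_
    rw [norm_mul, norm_mul, RCLike.norm_conj, norm_pow, norm_pow]
    exact mul_le_of_le_one_right (by positivity) (h.norm_le _)
  have ht : Filter.Tendsto (fun n : ℕ => Finset.range n ×ˢ Finset.range n) Filter.atTop
      Filter.atTop := by
    refine Filter.tendsto_atTop_finset_of_monotone
      (fun a b hab => Finset.product_subset_product (Finset.range_mono hab)
        (Finset.range_mono hab)) fun p => ⟨p.1 + p.2 + 1, ?_⟩
    simp only [Finset.mem_product, Finset.mem_range]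
    omega
  refine ⟨_, (hs.hasSum.comp ht).congr fun n => ?_⟩
  simp only [Function.comp_apply, covForm]
  rw [Finset.sum_product]

lemma one_sub_norm_sq_pos {z : ℂ} (hz : ‖z‖ < 1) : 0 < 1 - ‖z‖ ^ 2 := by
  nlinarith [norm_nonneg z]

/-- The recursion of `covForm_succ` passes to the limit as `B = Re H + |z|² B`, using `γ (-n) = conj
(γ n)` to pair the two single sums. -/
lemma tendsto_covForm (h : IsStationaryCov γ) {z : ℂ} (hz : ‖z‖ < 1) :
    Filter.Tendsto (fun n => covForm γ n (fun k => z ^ k)) Filter.atTop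
      (𝓝 (covKernel γ z : ℂ)) := by
  obtain ⟨B, hB⟩ := h.exists_tendsto_covForm hz
  have h1 := (Filter.tendsto_add_atTop_iff_nat 1).mpr hB
  have hH := h.tendsto_herglotz hz
  have hHc := (Complex.continuous_conj.tendsto _).comp hH
  have h2 : Filter.Tendsto (fun n => covForm γ (n + 1) (fun k => z ^ k)) Filter.atTop
      (𝓝 ((1 / 2) * (herglotz γ z + conj (herglotz γ z)) + z * conj z * B)) := by
    refine (((hH.add hHc).const_mul (1 / 2)).add (hB.const_mul (z * conj z))).congr fun n => ?_
    rw [covForm_succ h.zero]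
    simp only [Function.comp_apply, map_add, map_one, map_mul, map_sum, map_pow, map_ofNat,
      ← h.symm, neg_neg]
    ring
  have heq := tendsto_nhds_unique h1 h2
  rw [Complex.add_conj, Complex.mul_conj, Complex.normSq_eq_norm_sq] at heq
  have hne : (1 : ℂ) - ((‖z‖ ^ 2 : ℝ) : ℂ) ≠ 0 := by
    exact_mod_cast (one_sub_norm_sq_pos hz).ne'
  have : B = (covKernel γ z : ℂ) := by
    rw [covKernel]
    push_cast at heq hne ⊢
    field_simp
    linear_combination heq
  rwa [← this]

lemma herglotz_zero (γ : ℤ → ℂ) : herglotz γ 0 = 1 := by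
  rw [herglotz, tsum_eq_single 0 (fun n hn => by simp [hn])]
  simp [herglotzCoeff]

lemma re_herglotz_nonneg (h : IsStationaryCov γ) {z : ℂ} (hz : z ∈ ball (0 : ℂ) 1) :
    0 ≤ (herglotz γ z).re := by
  rw [mem_ball_zero_iff] at hz
  have h1 := (Complex.continuous_re.tendsto _).comp (h.tendsto_covForm hz)
  have h2 : 0 ≤ covKernel γ z := by
    have := ge_of_tendsto' h1 fun n => h.nonneg n _
    simpa using this
  rw [covKernel] at h2
  by_contra hneg
  exact absurd (div_neg_of_neg_of_pos (not_le.mp hneg) (one_sub_norm_sq_pos hz)) (not_lt.mpr h2)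

lemma differentiableOn_exp_neg_herglotz (h : IsStationaryCov γ) :
    DifferentiableOn ℂ (fun z => Complex.exp (-herglotz γ z)) (ball 0 1) :=
  (h.analyticOnNhd_herglotz.differentiableOn.neg).cexp

/-- Maximum principle for `exp (-H)`: its modulus `exp (-Re H)` is at most `1`, and a zero of `Re H`
would attain this maximum, forcing modulus `1` at the origin, where `H = 1`. -/
lemma re_herglotz_pos (h : IsStationaryCov γ) {z : ℂ} (hz : z ∈ ball (0 : ℂ) 1) :
    0 < (herglotz γ z).re := by
  refine (h.re_herglotz_nonneg hz).lt_of_ne fun h0 => ?_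
  have hmax : IsMaxOn (norm ∘ fun z => Complex.exp (-herglotz γ z)) (ball 0 1) z := by
    intro w hw
    simp only [Function.comp_apply, Complex.norm_exp, Complex.neg_re, ← h0, Set.mem_ofPred_eq]
    have := h.re_herglotz_nonneg hw
    gcongr
  have := Complex.norm_eqOn_of_isPreconnected_of_isMaxOn (convex_ball 0 1).isPreconnected
    isOpen_ball h.differentiableOn_exp_neg_herglotz hz hmax (mem_ball_self one_pos)
  simp only [Function.comp_apply, Complex.norm_exp, Complex.neg_re, ← h0, herglotz_zero,
    Function.const_apply] at this
  norm_num at this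

lemma covKernel_pos (h : IsStationaryCov γ) {z : ℂ} (hz : z ∈ ball (0 : ℂ) 1) :
    0 < covKernel γ z :=
  div_pos (h.re_herglotz_pos hz) (one_sub_norm_sq_pos (mem_ball_zero_iff.mp hz))

lemma continuousOn_re_herglotz (h : IsStationaryCov γ) :
    ContinuousOn (fun z => (herglotz γ z).re) (ball 0 1) :=
  Complex.continuous_re.comp_continuousOn h.analyticOnNhd_herglotz.continuousOn

lemma continuousOn_covKernel (h : IsStationaryCov γ) :
    ContinuousOn (covKernel γ) (ball 0 1) :=
  h.continuousOn_re_herglotz.div (by fun_prop)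
    fun _ hz => (one_sub_norm_sq_pos (mem_ball_zero_iff.mp hz)).ne'

lemma circleAverage_re_herglotz (h : IsStationaryCov γ) {c : ℂ} {R : ℝ} (hR : 0 < R)
    (hc : closedBall c R ⊆ ball 0 1) :
    Real.circleAverage (fun z => (herglotz γ z).re) c R = (herglotz γ c).re := by
  refine InnerProductSpace.HarmonicOnNhd.circleAverage_eq (f := fun z => (herglotz γ z).re) ?_
  intro z hz
  rw [abs_of_pos hR] at hz
  exact (h.analyticOnNhd_herglotz z (hc hz)).harmonicAt_re

end IsStationaryCov

/-! ### Jensen's inequality for `log (Re H)` and its equality case -/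

lemma circleAverage_nonneg_eq_zero {g : ℂ → ℝ} {c : ℂ} {R : ℝ} (hR : 0 < R)
    (hg : ContinuousOn g (sphere c R)) (h0 : ∀ z ∈ sphere c R, 0 ≤ g z)
    (hav : Real.circleAverage g c R = 0) : ∀ z ∈ sphere c R, g z = 0 := by
  have hpi : 0 < 2 * Real.pi := by positivity
  have hcont : Continuous fun θ => g (circleMap c R θ) :=
    hg.comp_continuous (continuous_circleMap c R) fun θ => circleMap_mem_sphere c hR.le θ
  by_contra! hne
  obtain ⟨z, hz, hgz⟩ := hne
  obtain ⟨θ, hθ, hθz⟩ : ∃ θ ∈ Set.Ioc 0 (2 * Real.pi), circleMap c R θ = z := by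
    have := image_circleMap_Ioc c R
    rw [abs_of_pos hR] at this
    rw [← this] at hz
    exact hz
  have hlt := intervalIntegral.integral_lt_integral_of_continuousOn_of_le_of_exists_lt
    (f := fun _ => (0 : ℝ)) (g := fun θ => g (circleMap c R θ)) hpi continuousOn_const
    hcont.continuousOn (fun θ _ => h0 _ (circleMap_mem_sphere c hR.le θ))
    ⟨θ, Set.Ioc_subset_Icc_self hθ, by
      rw [hθz]; exact lt_of_le_of_ne (h0 z hz) (Ne.symm hgz)⟩
  rw [Real.circleAverage_def, smul_eq_mul] at hav
  simp only [intervalIntegral.integral_zero] at hlt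
  have : 0 < (2 * Real.pi)⁻¹ * ∫ θ in 0..2 * Real.pi, g (circleMap c R θ) := by positivity
  linarith

namespace IsStationaryCov

variable {γ : ℤ → ℂ}

lemma continuousOn_log_re (h : IsStationaryCov γ) {c : ℂ} {R : ℝ}
    (hc : closedBall c R ⊆ ball 0 1) :
    ContinuousOn (fun z => Real.log (herglotz γ z).re) (sphere c R) :=
  ((h.continuousOn_re_herglotz.mono (sphere_subset_closedBall.trans hc)).log
    fun _ hz => (h.re_herglotz_pos (hc (sphere_subset_closedBall hz))).ne')

/-- The defect in Jensen's inequality for the concave function `log`. -/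
lemma circleAverage_log_defect (h : IsStationaryCov γ) {c : ℂ} {R : ℝ} (hR : 0 < R)
    (hc : closedBall c R ⊆ ball 0 1) :
    Real.circleAverage (fun z => (herglotz γ z).re / (herglotz γ c).re - 1 -
        (Real.log (herglotz γ z).re - Real.log (herglotz γ c).re)) c R =
      Real.log (herglotz γ c).re -
        Real.circleAverage (fun z => Real.log (herglotz γ z).re) c R := by
  have hpos := h.re_herglotz_pos (hc (mem_closedBall_self hR.le))
  have hi : CircleIntegrable (fun z => (herglotz γ z).re) c R :=
    (h.continuousOn_re_herglotz.mono (sphere_subset_closedBall.trans hc)).circleIntegrable hR.le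
  have hl : CircleIntegrable (fun z => Real.log (herglotz γ z).re) c R :=
    (h.continuousOn_log_re hc).circleIntegrable hR.le
  have hav := h.circleAverage_re_herglotz hR hc
  -- The tangent-line term `a / b - 1` averages to zero by the mean value property. Including it
  -- makes the integrand pointwise nonnegative.
  have e1 : (fun z => (herglotz γ z).re / (herglotz γ c).re - 1 -
        (Real.log (herglotz γ z).re - Real.log (herglotz γ c).re)) =
      ((((herglotz γ c).re)⁻¹ • fun z => (herglotz γ z).re) +
        fun _ => Real.log (herglotz γ c).re - 1) -
        fun z => Real.log (herglotz γ z).re := by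
    funext z
    simp only [Pi.sub_apply, Pi.add_apply, Pi.smul_apply, smul_eq_mul]
    ring
  have hconst : CircleIntegrable (fun _ : ℂ => Real.log (herglotz γ c).re - 1) c R :=
    circleIntegrable_const _ _ _
  rw [e1, Real.circleAverage_sub ((hi.const_smul).add hconst) hl,
    Real.circleAverage_add hi.const_smul hconst, Real.circleAverage_smul, hav,
    Real.circleAverage_const, smul_eq_mul, inv_mul_cancel₀ hpos.ne']
  ring

lemma defect_nonneg {a b : ℝ} (ha : 0 < a) (hb : 0 < b) :
    0 ≤ a / b - 1 - (Real.log a - Real.log b) := by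
  rw [← Real.log_div ha.ne' hb.ne']
  linarith [Real.log_le_sub_one_of_pos (div_pos ha hb)]

lemma circleAverage_log_re_le (h : IsStationaryCov γ) {c : ℂ} {R : ℝ} (hR : 0 < R)
    (hc : closedBall c R ⊆ ball 0 1) :
    Real.circleAverage (fun z => Real.log (herglotz γ z).re) c R ≤ Real.log (herglotz γ c).re := by
  rw [← sub_nonneg, ← h.circleAverage_log_defect hR hc, Real.circleAverage_def, smul_eq_mul]
  refine mul_nonneg (by positivity) (intervalIntegral.integral_nonneg (by positivity) fun θ _ => ?_)
  exact defect_nonneg (h.re_herglotz_pos (hc (circleMap_mem_closedBall c hR.le θ)))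
    (h.re_herglotz_pos (hc (mem_closedBall_self hR.le)))

/-- A continuous nonnegative integrand of zero average vanishes on the whole circle, and `log x < x
- 1` unless `x = 1`. -/
lemma re_herglotz_eq_of_circleAverage_eq (h : IsStationaryCov γ) {c : ℂ} {R : ℝ} (hR : 0 < R)
    (hc : closedBall c R ⊆ ball 0 1)
    (heq : Real.circleAverage (fun z => Real.log (herglotz γ z).re) c R =
      Real.log (herglotz γ c).re) {z : ℂ} (hz : z ∈ sphere c R) :
    (herglotz γ z).re = (herglotz γ c).re := by
  have hpos := h.re_herglotz_pos (hc (mem_closedBall_self hR.le))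
  have hsub := sphere_subset_closedBall.trans hc
  have hzpos := h.re_herglotz_pos (hsub hz)
  have h0 := circleAverage_nonneg_eq_zero hR
    ((((h.continuousOn_re_herglotz.mono hsub).div_const _).sub continuousOn_const).sub
      ((h.continuousOn_log_re hc).sub continuousOn_const))
    (fun w hw => defect_nonneg (h.re_herglotz_pos (hsub hw)) hpos)
    ((h.circleAverage_log_defect hR hc).trans (sub_eq_zero.mpr heq.symm)) z hz
  simp only [Pi.sub_apply] at h0
  by_contra hne
  have hne1 : (herglotz γ z).re / (herglotz γ c).re ≠ 1 :=
    fun h => hne ((div_eq_one_iff_eq hpos.ne').mp h)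
  have := Real.log_lt_sub_one_of_pos (div_pos hzpos hpos) hne1
  rw [Real.log_div hzpos.ne' hpos.ne'] at this
  linarith

/-- Near `c` the function `exp (-H)` has constant modulus, hence is constant by the maximum
principle, and is constant on the disk by the identity theorem. The value of `H` is fixed by `H 0 =
1`. -/
lemma herglotz_eq_one_of_locally_const (h : IsStationaryCov γ) {c : ℂ}
    (hc : c ∈ ball (0 : ℂ) 1)
    (heq : ∀ᶠ z in 𝓝 c, (herglotz γ z).re = (herglotz γ c).re) :
    ∀ z ∈ ball (0 : ℂ) 1, herglotz γ z = 1 := by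
  have hd := h.differentiableOn_exp_neg_herglotz
  have hev : ∀ᶠ y in 𝓝 c, Complex.exp (-herglotz γ y) = Complex.exp (-herglotz γ c) := by
    refine Complex.eventually_eq_of_isLocalMax_norm ?_ ?_
    · filter_upwards [isOpen_ball.mem_nhds hc] with z hz
      exact hd.differentiableAt (isOpen_ball.mem_nhds hz)
    · filter_upwards [heq] with z hz
      simp [Complex.norm_exp, hz]
  have hall := (hd.analyticOnNhd isOpen_ball).eqOn_of_preconnected_of_eventuallyEq
    (analyticOnNhd_const (v := Complex.exp (-herglotz γ c))) (convex_ball 0 1).isPreconnected hc hev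
  -- Constancy of `exp (-H)` determines `H` only modulo `2πi`; differentiating removes the
  -- ambiguity.
  have hderiv : ∀ z ∈ ball (0 : ℂ) 1, deriv (herglotz γ) z = 0 := by
    intro z hz
    have hdz := (h.analyticOnNhd_herglotz z hz).differentiableAt
    have h1 : deriv (fun z => Complex.exp (-herglotz γ z)) z = 0 := by
      have : (fun z => Complex.exp (-herglotz γ z)) =ᶠ[𝓝 z]
          fun _ => Complex.exp (-herglotz γ c) := by
        filter_upwards [isOpen_ball.mem_nhds hz] with w hw using hall hw
      rw [this.deriv_eq, deriv_const]
    have h2 : HasDerivAt (fun z => Complex.exp (-herglotz γ z)) _ z := hdz.hasDerivAt.neg.cexp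
    rw [h2.deriv] at h1
    simpa [Complex.exp_ne_zero] using h1
  intro z hz
  rw [← herglotz_zero γ]
  exact isOpen_ball.is_const_of_deriv_eq_zero (convex_ball 0 1).isPreconnected
    h.analyticOnNhd_herglotz.differentiableOn hderiv hz (mem_ball_self one_pos)

lemma eq_whiteCov (h : IsStationaryCov γ) (h1 : ∀ z ∈ ball (0 : ℂ) 1, herglotz γ z = 1) :
    γ = whiteCov := by
  have hneg : ∀ n : ℕ, n ≠ 0 → γ (-(n : ℤ)) = 0 := by
    intro n hn
    have := coeff_eq_zero_of_tsum_eq_const h.summable_herglotz h1 hn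
    simpa [herglotzCoeff, hn] using this
  funext n
  unfold whiteCov
  split_ifs with hn
  · rw [hn, h.zero]
  · rcases le_total 0 n with h0 | h0
    · lift n to ℕ using h0
      have h2 := hneg n (by exact_mod_cast hn)
      rw [h.symm] at h2
      simpa using h2
    · obtain ⟨m, rfl⟩ := Int.exists_eq_neg_ofNat h0
      exact hneg m (by intro h; simp [h] at hn)

end IsStationaryCov

lemma herglotz_whiteCov (z : ℂ) : herglotz whiteCov z = 1 := by
  rw [herglotz, tsum_eq_single 0 (fun n hn => by simp [hn, herglotzCoeff, whiteCov])]
  simp [herglotzCoeff]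

/-! ### Gaussian analytic functions and their laws -/

/-- `F` is a random analytic function on the unit disk whose value at `z` is a centered circularly
symmetric Gaussian of variance `K z > 0`. -/
structure IsGAF {Ω : Type*} [MeasurableSpace Ω] (P : Measure Ω) (F : Ω → ℂ → ℂ) (K : ℂ → ℝ) :
    Prop where
  measurable : Measurable (fun p : Ω × ℂ => F p.1 p.2)
  analytic : ∀ᵐ ω ∂P, AnalyticOnNhd ℂ (F ω) (ball 0 1)
  law : ∀ z ∈ ball (0 : ℂ) 1, P.map (fun ω => F ω z) =
    stdComplexGaussian.map (fun w => ((√(K z) : ℝ) : ℂ) * w)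
  continuousOn : ContinuousOn K (ball 0 1)
  pos : ∀ z ∈ ball (0 : ℂ) 1, 0 < K z

lemma measure_complex_ext {μ ν : Measure ℂ} [IsFiniteMeasure μ] [IsFiniteMeasure ν]
    (h : ∀ w : ℂ, ∫ z, Complex.exp (((w * z).re : ℂ) * Complex.I) ∂μ =
      ∫ z, Complex.exp (((w * z).re : ℂ) * Complex.I) ∂ν) : μ = ν := by
  refine Measure.ext_of_charFun (funext fun t => ?_)
  have hin : ∀ x : ℂ, inner ℝ x t = (conj t * x).re := by
    intro x
    rw [Complex.inner]
    simp
  rw [charFun_apply, charFun_apply]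
  simp_rw [hin]
  exact h (conj t)

section

variable {Ω : Type*} [MeasurableSpace Ω] {P : Measure Ω} {γ : ℤ → ℂ} {ξ : ℕ → Ω → ℂ}

namespace GaussianCoeffs

lemma congr (h : GaussianCoeffs P γ ξ) {ξ' : ℕ → Ω → ℂ} (hξ : ∀ k, ξ k =ᵐ[P] ξ' k) :
    GaussianCoeffs P γ ξ' where
  toIsStationaryCov := h.toIsStationaryCov
  aemeasurable k := (h.aemeasurable k).congr (hξ k)
  integral_exp n w := by
    rw [← h.integral_exp n w]
    refine integral_congr_ae ?_
    filter_upwards [ae_all_iff.mpr hξ] with ω hω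
    simp_rw [hω]

variable [IsProbabilityMeasure P]

lemma map_eq_std (h : GaussianCoeffs P γ ξ) (k : ℕ) : P.map (ξ k) = stdComplexGaussian := by
  have := Measure.isProbabilityMeasure_map (h.aemeasurable k)
  refine measure_complex_ext fun w => ?_
  rw [stdComplexGaussian_integral_exp, integral_map (h.aemeasurable k) (by fun_prop)]
  have := h.integral_exp (k + 1) (fun j => if j = k then w else 0)
  have h1 : ∀ ω, ∑ j ∈ Finset.range (k + 1), (if j = k then w else 0) * ξ j ω = w * ξ k ω := by
    intro ω
    rw [Finset.sum_eq_single k (fun j _ hj => by simp [hj]) (fun hk => by simp at hk)]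
    simp
  have h2 : covForm γ (k + 1) (fun j => if j = k then w else 0) = w * conj w := by
    rw [covForm, Finset.sum_eq_single k (fun j _ hj => by simp [hj]) (fun hk => by simp at hk),
      Finset.sum_eq_single k (fun j _ hj => by simp [hj]) (fun hk => by simp at hk)]
    simp [h.zero]
  simp_rw [h1, h2] at this
  exact this

/-- All coefficients have the same finite first absolute moment, so `E ∑ |ξ_k| r^k` is finite
without any independence. Countably many radii `1 - meshRadius j` suffice by monotonicity. -/
lemma ae_summable (h : GaussianCoeffs P γ ξ) :
    ∀ᵐ ω ∂P, ∀ r : ℝ, 0 ≤ r → r < 1 → Summable fun k => ‖ξ k ω‖ * r ^ k := by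
  have hfin : ∀ k, ∫⁻ ω, ‖ξ k ω‖ₑ ∂P = ∫⁻ z, ‖z‖ₑ ∂stdComplexGaussian := by
    intro k
    rw [← h.map_eq_std k, lintegral_map' (by fun_prop) (h.aemeasurable k)]
  have hm : ∫⁻ z, ‖z‖ₑ ∂stdComplexGaussian ≠ ⊤ := by
    have := integrable_norm_stdComplexGaussian.hasFiniteIntegral
    rw [HasFiniteIntegral] at this
    simpa using this.ne
  have key : ∀ j : ℕ, ∀ᵐ ω ∂P, Summable fun k => ‖ξ k ω‖ * (1 - meshRadius j) ^ k := by
    intro j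
    have hr0 : 0 ≤ 1 - meshRadius j := by
      unfold meshRadius
      rw [sub_nonneg]
      exact div_le_one_of_le₀ (by linarith [(Nat.cast_nonneg j : (0 : ℝ) ≤ j)]) (by positivity)
    have hr1 : 1 - meshRadius j < 1 := by linarith [meshRadius_pos j]
    set r := 1 - meshRadius j
    have hmeas : ∀ k, AEMeasurable (fun ω => ‖ξ k ω‖ₑ * ENNReal.ofReal (r ^ k)) P :=
      fun k => (h.aemeasurable k).enorm.mul_const _
    have hsum : ∫⁻ ω, ∑' k, ‖ξ k ω‖ₑ * ENNReal.ofReal (r ^ k) ∂P ≠ ⊤ := by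
      rw [lintegral_tsum hmeas]
      have : ∀ k, ∫⁻ ω, ‖ξ k ω‖ₑ * ENNReal.ofReal (r ^ k) ∂P =
          (∫⁻ z, ‖z‖ₑ ∂stdComplexGaussian) * ENNReal.ofReal (r ^ k) := fun k => by
        rw [lintegral_mul_const'' _ (h.aemeasurable k).enorm, hfin]
      simp_rw [this]
      rw [ENNReal.tsum_mul_left,
        ← ENNReal.ofReal_tsum_of_nonneg (fun k => by positivity)
          (summable_geometric_of_lt_one hr0 hr1)]
      exact ENNReal.mul_ne_top hm ENNReal.ofReal_ne_top
    filter_upwards [ae_lt_top' (AEMeasurable.tsum hmeas) hsum] with ω hω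
    have := ENNReal.summable_toReal hω.ne
    refine this.congr fun k => ?_
    rw [ENNReal.toReal_mul, toReal_enorm, ENNReal.toReal_ofReal (by positivity)]
  filter_upwards [ae_all_iff.mpr key] with ω hω r hr0 hr1
  obtain ⟨j, hj⟩ := exists_nat_one_div_lt (sub_pos.mpr hr1)
  refine Summable.of_nonneg_of_le (fun k => by positivity) (fun k => ?_) (hω j)
  have : r ≤ 1 - meshRadius j := by unfold meshRadius; linarith
  gcongr

/-- Characteristic functions of the partial sums converge by dominated convergence, and their
exponents converge by `tendsto_covForm`. -/
lemma map_randomPowerSeries (h : GaussianCoeffs P γ ξ)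
    {z : ℂ} (hz : z ∈ ball (0 : ℂ) 1) :
    P.map (fun ω => randomPowerSeries ξ ω z) =
      stdComplexGaussian.map (fun w => ((√(covKernel γ z) : ℝ) : ℂ) * w) := by
  have hF : AEMeasurable (fun ω => randomPowerSeries ξ ω z) P :=
    AEMeasurable.tsum fun k => (h.aemeasurable k).mul_const _
  have hG : Measurable fun w : ℂ => ((√(covKernel γ z) : ℝ) : ℂ) * w := by fun_prop
  have := Measure.isProbabilityMeasure_map (μ := P) hF
  have := Measure.isProbabilityMeasure_map (μ := stdComplexGaussian) hG.aemeasurable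
  have hz1 := mem_ball_zero_iff.mp hz
  refine measure_complex_ext fun w => ?_
  rw [integral_map hF (by fun_prop), integral_map hG.aemeasurable (by fun_prop)]
  simp_rw [← mul_assoc]
  rw [stdComplexGaussian_integral_exp]
  have hlim : Filter.Tendsto (fun n => ∫ ω, Complex.exp
      (((∑ k ∈ Finset.range n, w * z ^ k * ξ k ω).re : ℂ) * Complex.I) ∂P) Filter.atTop
      (𝓝 (∫ ω, Complex.exp (((w * randomPowerSeries ξ ω z).re : ℂ) * Complex.I) ∂P)) := by
    refine tendsto_integral_of_dominated_convergence (fun _ => 1) (fun n => ?_)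
      (integrable_const _) (fun n => Filter.Eventually.of_forall fun ω => ?_) ?_
    · have hk := h.aemeasurable
      have : AEMeasurable (fun ω => Complex.exp
        (((∑ k ∈ Finset.range n, w * z ^ k * ξ k ω).re : ℂ) * Complex.I)) P := by fun_prop
      exact this.aestronglyMeasurable
    · rw [Complex.norm_exp_ofReal_mul_I]
    · filter_upwards [h.ae_summable] with ω hω
      have hs : Summable fun k => ξ k ω * z ^ k := by
        refine Summable.of_norm ?_
        simp_rw [norm_mul, norm_pow]
        exact hω _ (norm_nonneg _) hz1
      have h1 := (hs.hasSum.tendsto_sum_nat).const_mul w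
      have h2 : Continuous fun x : ℂ => Complex.exp ((x.re : ℂ) * Complex.I) := by fun_prop
      refine ((h2.tendsto _).comp h1).congr fun n => ?_
      simp only [Function.comp_apply, Finset.mul_sum]
      congr 4
      refine Finset.sum_congr rfl fun k _ => ?_
      ring
  have hform : ∀ n, covForm γ n (fun k => w * z ^ k) =
      w * conj w * covForm γ n (fun k => z ^ k) := by
    intro n
    simp_rw [covForm, Finset.mul_sum]
    refine Finset.sum_congr rfl fun k _ => Finset.sum_congr rfl fun l _ => ?_
    rw [map_mul]
    ring
  have hlim2 : Filter.Tendsto (fun n => ∫ ω, Complex.exp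
      (((∑ k ∈ Finset.range n, w * z ^ k * ξ k ω).re : ℂ) * Complex.I) ∂P) Filter.atTop
      (𝓝 (Complex.exp (-(1 / 4) * (w * conj w * covKernel γ z)))) := by
    simp_rw [h.integral_exp _ (fun k => w * z ^ k), hform]
    exact (Complex.continuous_exp.tendsto _).comp
      (((h.tendsto_covForm hz1).const_mul _).const_mul _)
  rw [tendsto_nhds_unique hlim hlim2]
  congr 1
  rw [map_mul, Complex.conj_ofReal]
  have : ((√(covKernel γ z) : ℝ) : ℂ) * ((√(covKernel γ z) : ℝ) : ℂ) = covKernel γ z := by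
    rw [← Complex.ofReal_mul, Real.mul_self_sqrt (h.covKernel_pos hz).le]
  rw [← this]
  ring

lemma isGAF (h : GaussianCoeffs P γ ξ) (hm : ∀ k, Measurable (ξ k)) :
    IsGAF P (randomPowerSeries ξ) (covKernel γ) where
  measurable := by
    unfold randomPowerSeries
    fun_prop
  analytic := by
    filter_upwards [h.ae_summable] with ω hω
    exact analyticOnNhd_tsum_pow hω
  law z hz := h.map_randomPowerSeries hz
  continuousOn := h.continuousOn_covKernel
  pos _ hz := h.covKernel_pos hz

/-- Every real functional of finitely many coefficients is the real part of a complex linear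
combination, so equal covariances give equal finite-dimensional characteristic functions; uniqueness
of projective limits does the rest. -/
lemma identDistrib_coeffs (h : GaussianCoeffs P γ ξ) {Ω' : Type*} [MeasurableSpace Ω']
    {P' : Measure Ω'} [IsProbabilityMeasure P'] {ζ : ℕ → Ω' → ℂ} (h' : GaussianCoeffs P' γ ζ) :
    IdentDistrib (fun ω k => ξ k ω) (fun ω k => ζ k ω) P P' := by
  have hm : AEMeasurable (fun ω k => ξ k ω) P := aemeasurable_pi_lambda _ h.aemeasurable
  have hm' : AEMeasurable (fun ω k => ζ k ω) P' := aemeasurable_pi_lambda _ h'.aemeasurable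
  have i1 := Measure.isProbabilityMeasure_map hm
  have i2 := Measure.isProbabilityMeasure_map hm'
  refine ⟨hm, hm', ?_⟩
  have hproj : ∀ I : Finset ℕ, (P.map (fun ω k => ξ k ω)).map I.restrict =
      (P'.map (fun ω k => ζ k ω)).map I.restrict := by
    intro I
    have hr : Measurable (I.restrict (π := fun _ : ℕ => ℂ)) := Finset.measurable_restrict I
    have i3 := Measure.isProbabilityMeasure_map (μ := P.map (fun ω k => ξ k ω)) hr.aemeasurable
    have i4 := Measure.isProbabilityMeasure_map (μ := P'.map (fun ω k => ζ k ω)) hr.aemeasurable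
    refine Measure.ext_of_charFunDual (funext fun L => ?_)
    obtain ⟨n, w, hw⟩ : ∃ (n : ℕ) (w : ℕ → ℂ), ∀ x : ℕ → ℂ,
        L (I.restrict x) = (∑ k ∈ Finset.range n, w k * x k).re := by
      classical
      -- With `w = L e - i L (i e)` one has `Re (w x) = Re x · L e + Im x · L (i e)`.
      let w : ℕ → ℂ := fun k => if hk : k ∈ I then
        (L (Pi.single ⟨k, hk⟩ 1) : ℂ) - (L (Pi.single ⟨k, hk⟩ Complex.I) : ℂ) * Complex.I else 0
      refine ⟨I.sup id + 1, w, fun x => ?_⟩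
      have hsub : I ⊆ Finset.range (I.sup id + 1) := fun k hk =>
        Finset.mem_range.mpr (Nat.lt_succ_of_le (Finset.le_sup (f := id) hk))
      rw [← Finset.sum_subset hsub (fun k _ hk => by simp [w, hk]), ← Finset.sum_coe_sort,
        Complex.re_sum]
      have hx : I.restrict x = ∑ k : I, ((x k).re • (Pi.single k 1 : I → ℂ) +
          (x k).im • (Pi.single k Complex.I : I → ℂ)) := by
        funext j
        rw [Finset.sum_apply, Finset.sum_eq_single j]
        · simp
        · intro b _ hb
          simp [Pi.single_eq_of_ne hb.symm]
        · simp
      rw [hx, map_sum]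
      refine Finset.sum_congr rfl fun k _ => ?_
      rw [map_add, map_smul, map_smul]
      simp [w]
      ring
    have hc : Measurable fun x : ℕ → ℂ => Complex.exp ((L (I.restrict x) : ℂ) * Complex.I) := by
      fun_prop
    have hc' : Measurable fun x : I → ℂ => Complex.exp ((L x : ℂ) * Complex.I) := by
      fun_prop
    rw [charFunDual_apply, charFunDual_apply,
      integral_map hr.aemeasurable hc'.aestronglyMeasurable,
      integral_map hr.aemeasurable hc'.aestronglyMeasurable,
      integral_map hm hc.aestronglyMeasurable, integral_map hm' hc.aestronglyMeasurable]
    simp_rw [hw]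
    rw [h.integral_exp, h'.integral_exp]
  refine IsProjectiveLimit.unique (P := fun I => (P.map (fun ω k => ξ k ω)).map I.restrict)
    (fun I => rfl) (fun I => (hproj I).symm)

lemma equalInLaw (h : GaussianCoeffs P γ ξ) {Ω' : Type*} [MeasurableSpace Ω']
    {P' : Measure Ω'} [IsProbabilityMeasure P'] {ζ : ℕ → Ω' → ℂ} (h' : GaussianCoeffs P' γ ζ) :
    EqualInLaw P P' ξ ζ := by
  have hΦ : Measurable fun (x : ℕ → ℂ) (z : ball (0 : ℂ) 1) => ∑' k, x k * (z : ℂ) ^ k := by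
    rw [measurable_pi_iff]
    intro z
    fun_prop
  exact (h.identDistrib_coeffs h').comp hΦ

/-- The one-point law at `z` has characteristic function `exp (-K z / 4)` at frequency `1`, which is
injective in `K z`. -/
lemma covKernel_eq_of_equalInLaw (h : GaussianCoeffs P γ ξ)
    {Ω' : Type*} [MeasurableSpace Ω']
    {P' : Measure Ω'} [IsProbabilityMeasure P'] {γ' : ℤ → ℂ} {ζ : ℕ → Ω' → ℂ}
    (h' : GaussianCoeffs P' γ' ζ) (heq : EqualInLaw P P' ξ ζ) {z : ℂ} (hz : z ∈ ball (0 : ℂ) 1) :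
    covKernel γ z = covKernel γ' z := by
  have h1 := (heq.comp (measurable_pi_apply (⟨z, hz⟩ : ball (0 : ℂ) 1))).map_eq
  have h2 : P.map (fun ω => randomPowerSeries ξ ω z) =
    P'.map (fun ω => randomPowerSeries ζ ω z) := h1
  rw [h.map_randomPowerSeries hz, h'.map_randomPowerSeries hz] at h2
  have hval : ∀ a : ℝ, 0 ≤ a → ∫ x, Complex.exp (((1 * x).re : ℂ) * Complex.I)
      ∂(stdComplexGaussian.map (fun w => ((√a : ℝ) : ℂ) * w)) =
      ((Real.exp (-(1 / 4) * a) : ℝ) : ℂ) := by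
    intro a ha
    have hG : Measurable fun w : ℂ => ((√a : ℝ) : ℂ) * w := by fun_prop
    rw [integral_map hG.aemeasurable (by fun_prop)]
    simp_rw [one_mul]
    rw [stdComplexGaussian_integral_exp, Complex.conj_ofReal, ← Complex.ofReal_mul,
      Real.mul_self_sqrt ha]
    push_cast
    rfl
  have h3 := congrArg (fun μ => ∫ x, Complex.exp (((1 * x).re : ℂ) * Complex.I) ∂μ) h2
  rw [hval _ (h.covKernel_pos hz).le, hval _ (h'.covKernel_pos hz).le] at h3
  have h4 := Real.exp_injective (Complex.ofReal_injective h3)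
  linarith

end GaussianCoeffs

end

/-! ### Expected Jensen sums -/

/-- The expectation of `log |Z|` for a standard complex Gaussian `Z`. -/
def stdLogMean : ℝ := ∫ w, Real.log ‖w‖ ∂stdComplexGaussian

/-- Half the excess of the circle average of `log K` over its value at the center. -/
def jensenDensity (K : ℂ → ℝ) (c : ℂ) (R : ℝ) : ℝ :=
  (1 / 2) * (Real.circleAverage (fun z => Real.log (K z)) c R - Real.log (K c))

namespace IsGAF

variable {Ω : Type*} [MeasurableSpace Ω] {P : Measure Ω} {F : Ω → ℂ → ℂ} {K : ℂ → ℝ}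

lemma measurable_eval (h : IsGAF P F K) (z : ℂ) : Measurable fun ω => F ω z :=
  h.measurable.comp (measurable_id.prodMk measurable_const)

lemma ae_ne_zero (h : IsGAF P F K) {z : ℂ} (hz : z ∈ ball (0 : ℂ) 1) : ∀ᵐ ω ∂P, F ω z ≠ 0 := by
  have hG : Measurable fun w : ℂ => ((√(K z) : ℝ) : ℂ) * w := by fun_prop
  have h1 : P.map (fun ω => F ω z) {0} = 0 := by
    rw [h.law z hz, Measure.map_apply hG (measurableSet_singleton _)]
    have : (fun w : ℂ => ((√(K z) : ℝ) : ℂ) * w) ⁻¹' {0} = {0} := by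
      ext w
      have := (Real.sqrt_pos.mpr (h.pos z hz)).ne'
      simp [this]
    rw [this, stdComplexGaussian_zero]
  rw [Measure.map_apply (h.measurable_eval z) (measurableSet_singleton _)] at h1
  rw [ae_iff]
  simpa using! h1

lemma log_norm_law {K : ℂ → ℝ} {z : ℂ} (hpos : 0 < K z) :
    ∀ᵐ w ∂stdComplexGaussian, Real.log ‖((√(K z) : ℝ) : ℂ) * w‖ =
      (1 / 2) * Real.log (K z) + Real.log ‖w‖ := by
  have hne : ∀ᵐ w ∂stdComplexGaussian, w ≠ 0 := by
    rw [ae_iff]; simpa using stdComplexGaussian_zero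
  filter_upwards [hne] with w hw
  rw [norm_mul, Real.log_mul (by simpa using (Real.sqrt_pos.mpr hpos).ne') (by simpa using hw),
    Complex.norm_real, Real.norm_of_nonneg (Real.sqrt_nonneg _), Real.log_sqrt hpos.le]
  ring

lemma measurable_log_norm : Measurable fun w : ℂ => Real.log ‖w‖ := by fun_prop

lemma integrable_log_norm (h : IsGAF P F K) {z : ℂ} (hz : z ∈ ball (0 : ℂ) 1) :
    Integrable (fun ω => Real.log ‖F ω z‖) P := by
  have hG : Measurable fun w : ℂ => ((√(K z) : ℝ) : ℂ) * w := by fun_prop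
  have h1 : Integrable (fun w : ℂ => Real.log ‖w‖) (P.map (fun ω => F ω z)) := by
    rw [h.law z hz, integrable_map_measure measurable_log_norm.aestronglyMeasurable hG.aemeasurable]
    refine Integrable.congr ?_ ((log_norm_law (h.pos z hz)).mono fun w hw => hw.symm)
    exact (integrable_const _).add integrable_log_norm_stdComplexGaussian
  exact (integrable_map_measure measurable_log_norm.aestronglyMeasurable
    (h.measurable_eval z).aemeasurable).mp h1

/-- The logarithm splits the scale `√(K z)` from a universal constant, and that constant cancels in
Jensen's difference. -/
lemma integral_log_norm (h : IsGAF P F K) {z : ℂ} (hz : z ∈ ball (0 : ℂ) 1) :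
    ∫ ω, Real.log ‖F ω z‖ ∂P = (1 / 2) * Real.log (K z) + stdLogMean := by
  have hG : Measurable fun w : ℂ => ((√(K z) : ℝ) : ℂ) * w := by fun_prop
  rw [← integral_map (h.measurable_eval z).aemeasurable
    (measurable_log_norm.aestronglyMeasurable), h.law z hz,
    integral_map hG.aemeasurable measurable_log_norm.aestronglyMeasurable,
    integral_congr_ae (log_norm_law (h.pos z hz)),
    integral_add (integrable_const _) integrable_log_norm_stdComplexGaussian, integral_const]
  simp [stdLogMean]

lemma integral_abs_log_norm_le (h : IsGAF P F K) {z : ℂ} (hz : z ∈ ball (0 : ℂ) 1) :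
    ∫ ω, ‖Real.log ‖F ω z‖‖ ∂P ≤
      (1 / 2) * |Real.log (K z)| + ∫ w, |Real.log ‖w‖| ∂stdComplexGaussian := by
  have hG : Measurable fun w : ℂ => ((√(K z) : ℝ) : ℂ) * w := by fun_prop
  have hint := integrable_log_norm_stdComplexGaussian.abs
  rw [← integral_map (f := fun w : ℂ => ‖Real.log ‖w‖‖) (h.measurable_eval z).aemeasurable
    (measurable_log_norm.norm.aestronglyMeasurable), h.law z hz,
    integral_map hG.aemeasurable measurable_log_norm.norm.aestronglyMeasurable]
  calc _ ≤ ∫ w, ((1 / 2) * |Real.log (K z)| + |Real.log ‖w‖|) ∂stdComplexGaussian := by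
        refine integral_mono_of_nonneg (Filter.Eventually.of_forall fun _ => norm_nonneg _)
          ((integrable_const _).add hint) ?_
        filter_upwards [log_norm_law (h.pos z hz)] with w hw
        rw [hw, Real.norm_eq_abs]
        refine (abs_add_le _ _).trans_eq ?_
        rw [abs_mul, abs_of_pos (by norm_num : (0 : ℝ) < 1 / 2)]
    _ = _ := by
        rw [integral_add (integrable_const _) hint, integral_const]
        simp

section Circle

variable {c : ℂ} {R : ℝ}

lemma circleMap_mem (hR : 0 < R) (hc : closedBall c R ⊆ ball 0 1) (θ : ℝ) :
    circleMap c R θ ∈ ball (0 : ℂ) 1 := hc (circleMap_mem_closedBall c hR.le θ)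

lemma jensenSum_ae (h : IsGAF P F K) (hR : 0 < R) (hc : closedBall c R ⊆ ball 0 1) :
    ∀ᵐ ω ∂P, jensenSum (F ω) c R = ENNReal.ofReal
        (Real.circleAverage (fun z => Real.log ‖F ω z‖) c R - Real.log ‖F ω c‖) ∧
      0 ≤ Real.circleAverage (fun z => Real.log ‖F ω z‖) c R - Real.log ‖F ω c‖ := by
  filter_upwards [h.analytic, h.ae_ne_zero (hc (mem_closedBall_self hR.le))] with ω h1 h2
  exact jensenSum_eq h1 hR hc h2

variable [IsProbabilityMeasure P]

/-- Justifies Fubini on the circle: `E |log |F z||` is bounded by a continuous function of `z`,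
hence uniformly on the compact disk. -/
lemma integrable_prod_log (h : IsGAF P F K) (hR : 0 < R) (hc : closedBall c R ⊆ ball 0 1) :
    Integrable (fun p : Ω × ℝ => Real.log ‖F p.1 (circleMap c R p.2)‖)
      (P.prod (volume.restrict (Set.Ioc 0 (2 * Real.pi)))) := by
  have hmeas : Measurable fun p : Ω × ℝ => Real.log ‖F p.1 (circleMap c R p.2)‖ := by
    have : Measurable fun p : Ω × ℝ => F p.1 (circleMap c R p.2) :=
      h.measurable.comp (measurable_fst.prodMk
        ((continuous_circleMap c R).measurable.comp measurable_snd))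
    exact measurable_log_norm.comp this
  have hcont : ContinuousOn (fun z => (1 / 2) * |Real.log (K z)| +
      ∫ w, |Real.log ‖w‖| ∂stdComplexGaussian) (closedBall c R) := by
    refine (ContinuousOn.mul continuousOn_const ?_).add continuousOn_const
    exact ((h.continuousOn.mono hc).log fun z hz => (h.pos z (hc hz)).ne').abs
  obtain ⟨M, hM⟩ := (isCompact_closedBall c R).exists_bound_of_continuousOn hcont
  rw [integrable_prod_iff' hmeas.aestronglyMeasurable]
  refine ⟨Filter.Eventually.of_forall fun θ => h.integrable_log_norm (circleMap_mem hR hc θ), ?_⟩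
  refine Integrable.mono' (integrable_const M) ?_ (Filter.Eventually.of_forall fun θ => ?_)
  · exact (hmeas.norm.stronglyMeasurable.integral_prod_left' ).aestronglyMeasurable
  · rw [Real.norm_of_nonneg (integral_nonneg fun _ => norm_nonneg _)]
    refine (h.integral_abs_log_norm_le (circleMap_mem hR hc θ)).trans ?_
    exact (le_abs_self _).trans (hM _ (circleMap_mem_closedBall c hR.le θ))

lemma circleAverage_eq_integral (g : ℂ → ℝ) (c : ℂ) (R : ℝ) : Real.circleAverage g c R =
    (2 * Real.pi)⁻¹ * ∫ θ in Set.Ioc 0 (2 * Real.pi), g (circleMap c R θ) := by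
  rw [Real.circleAverage_def, intervalIntegral.integral_of_le (by positivity), smul_eq_mul]

lemma integrable_circleAverage (h : IsGAF P F K) (hR : 0 < R) (hc : closedBall c R ⊆ ball 0 1) :
    Integrable (fun ω => Real.circleAverage (fun z => Real.log ‖F ω z‖) c R) P := by
  simp_rw [circleAverage_eq_integral]
  exact ((h.integrable_prod_log hR hc).integral_prod_left).const_mul _

lemma integral_circleAverage (h : IsGAF P F K) (hR : 0 < R) (hc : closedBall c R ⊆ ball 0 1) :
    ∫ ω, Real.circleAverage (fun z => Real.log ‖F ω z‖) c R ∂P =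
      (1 / 2) * Real.circleAverage (fun z => Real.log (K z)) c R + stdLogMean := by
  simp_rw [circleAverage_eq_integral]
  rw [integral_const_mul, integral_integral_swap (h.integrable_prod_log hR hc)]
  have h1 : ∀ θ, ∫ ω, Real.log ‖F ω (circleMap c R θ)‖ ∂P =
      (1 / 2) * Real.log (K (circleMap c R θ)) + stdLogMean :=
    fun θ => h.integral_log_norm (circleMap_mem hR hc θ)
  simp_rw [h1]
  have hcont : Continuous fun θ => Real.log (K (circleMap c R θ)) := by
    refine Continuous.log ?_ fun θ => (h.pos _ (circleMap_mem hR hc θ)).ne'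
    exact h.continuousOn.comp_continuous (continuous_circleMap c R) (circleMap_mem hR hc)
  have hint : Integrable (fun θ => Real.log (K (circleMap c R θ)))
      (volume.restrict (Set.Ioc 0 (2 * Real.pi))) :=
    (hcont.integrableOn_Icc).mono_set Set.Ioc_subset_Icc_self
  rw [integral_add (hint.const_mul _) (integrable_const _), integral_const_mul, integral_const]
  have : (volume.restrict (Set.Ioc 0 (2 * Real.pi))).real Set.univ = 2 * Real.pi := by
    simp [Real.pi_pos.le]
  rw [this, smul_eq_mul]
  field_simp

lemma integral_jensen (h : IsGAF P F K) (hR : 0 < R) (hc : closedBall c R ⊆ ball 0 1) :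
    ∫ ω, (Real.circleAverage (fun z => Real.log ‖F ω z‖) c R - Real.log ‖F ω c‖) ∂P =
      jensenDensity K c R := by
  have hcb := hc (mem_closedBall_self hR.le)
  rw [integral_sub (h.integrable_circleAverage hR hc) (h.integrable_log_norm hcb),
    h.integral_circleAverage hR hc, h.integral_log_norm hcb, jensenDensity]
  ring

lemma jensenDensity_nonneg (h : IsGAF P F K) (hR : 0 < R) (hc : closedBall c R ⊆ ball 0 1) :
    0 ≤ jensenDensity K c R := by
  rw [← h.integral_jensen hR hc]
  exact integral_nonneg_of_ae ((h.jensenSum_ae hR hc).mono fun ω hω => hω.2)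

lemma lintegral_jensenSum (h : IsGAF P F K) (hR : 0 < R) (hc : closedBall c R ⊆ ball 0 1) :
    ∫⁻ ω, jensenSum (F ω) c R ∂P = ENNReal.ofReal (jensenDensity K c R) := by
  have hcb := hc (mem_closedBall_self hR.le)
  rw [← h.integral_jensen hR hc, ofReal_integral_eq_lintegral_ofReal
    (f := fun ω => Real.circleAverage (fun z => Real.log ‖F ω z‖) c R - Real.log ‖F ω c‖) ((h.integrable_circleAverage hR hc).sub (h.integrable_log_norm hcb))
    ((h.jensenSum_ae hR hc).mono fun ω hω => hω.2)]
  exact lintegral_congr_ae ((h.jensenSum_ae hR hc).mono fun ω hω => hω.1)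

end Circle

/-- The right-hand side of Jensen's formula for `F ω`. -/
def jensenRHS (F : Ω → ℂ → ℂ) (R : ℝ) (p : Ω × ℂ) : ℝ≥0∞ :=
  ENNReal.ofReal (Real.circleAverage (fun z => Real.log ‖F p.1 z‖) p.2 R - Real.log ‖F p.1 p.2‖)

lemma measurable_jensenRHS (h : IsGAF P F K) (R : ℝ) : Measurable (jensenRHS F R) := by
  have h1 : Measurable fun q : (Ω × ℂ) × ℝ => Real.log ‖F q.1.1 (circleMap q.1.2 R q.2)‖ := by
    have hcm : Measurable fun q : (Ω × ℂ) × ℝ => circleMap q.1.2 R q.2 := by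
      unfold circleMap; fun_prop
    have : Measurable fun q : (Ω × ℂ) × ℝ => F q.1.1 (circleMap q.1.2 R q.2) :=
      h.measurable.comp ((measurable_fst.comp measurable_fst).prodMk hcm)
    exact measurable_log_norm.comp this
  have h2 : Measurable fun p : Ω × ℂ =>
      Real.circleAverage (fun z => Real.log ‖F p.1 z‖) p.2 R := by
    simp_rw [circleAverage_eq_integral]
    exact (h1.stronglyMeasurable.integral_prod_right').measurable.const_mul _
  have h3 : Measurable fun p : Ω × ℂ => Real.log ‖F p.1 p.2‖ :=
    measurable_log_norm.comp h.measurable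
  exact (h2.sub h3).ennreal_ofReal

/-! ### Expected zero counts -/

section Average

lemma ae_good (h : IsGAF P F K) :
    ∀ᵐ ω ∂P, AnalyticOnNhd ℂ (F ω) (ball 0 1) ∧ F ω 0 ≠ 0 := by
  filter_upwards [h.analytic, h.ae_ne_zero (mem_ball_self one_pos)] with ω h1 h2
  exact ⟨h1, h2⟩

/-- Jensen's formula can fail only at centres that are zeros, a null set. This replaces the Jensen
sum, whose joint measurability is unclear, by the jointly measurable `jensenRHS`. -/
lemma setLIntegral_jensenSum_ae (h : IsGAF P F K) {R : ℝ} (hR : 0 < R) {E : Set ℂ}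
    (hE : MeasurableSet E) (hc : ∀ c ∈ E, closedBall c R ⊆ ball 0 1) :
    ∀ᵐ ω ∂P, ∫⁻ c in E, jensenSum (F ω) c R = ∫⁻ c in E, jensenRHS F R (ω, c) := by
  filter_upwards [h.ae_good] with ω ⟨h1, h2⟩
  refine setLIntegral_congr_fun_ae hE ?_
  have hz := (countable_zeros h1 (mem_ball_self one_pos) h2).measure_zero volume
  filter_upwards [measure_eq_zero_iff_ae_notMem.mp hz] with c hcz hcE
  have hcb := hc c hcE (mem_closedBall_self hR.le)
  exact (jensenSum_eq h1 hR (hc c hcE) fun h0 => hcz ⟨hcb, h0⟩).1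

lemma aemeasurable_setLIntegral_jensenSum (h : IsGAF P F K) {R : ℝ} (hR : 0 < R) {E : Set ℂ}
    (hE : MeasurableSet E) (hc : ∀ c ∈ E, closedBall c R ⊆ ball 0 1) :
    AEMeasurable (fun ω => ∫⁻ c in E, jensenSum (F ω) c R) P :=
  ((h.measurable_jensenRHS R).lintegral_prod_right').aemeasurable.congr
    ((h.setLIntegral_jensenSum_ae hR hE hc).mono fun _ hω => hω.symm)

lemma lintegral_setLIntegral_jensenSum [IsProbabilityMeasure P] (h : IsGAF P F K) {R : ℝ} (hR : 0 < R) {E : Set ℂ}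
    (hE : MeasurableSet E) (hc : ∀ c ∈ E, closedBall c R ⊆ ball 0 1) :
    ∫⁻ ω, (∫⁻ c in E, jensenSum (F ω) c R) ∂P =
      ∫⁻ c in E, ENNReal.ofReal (jensenDensity K c R) := by
  rw [lintegral_congr_ae (h.setLIntegral_jensenSum_ae hR hE hc),
    lintegral_lintegral_swap (f := fun ω c => jensenRHS F R (ω, c))
      (h.measurable_jensenRHS R).aemeasurable]
  refine setLIntegral_congr_fun hE fun c hcE => ?_
  rw [← h.lintegral_jensenSum hR (hc c hcE)]
  exact lintegral_congr_ae ((h.jensenSum_ae hR (hc c hcE)).mono fun ω hω => hω.1.symm)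

/-- Averaged Jensen sums, which approximate the zero count of `f` in `D` from below. -/
def approxCount (f : ℂ → ℂ) (D : Set ℂ) (j : ℕ) : ℝ≥0∞ :=
  (logMass (meshRadius j))⁻¹ * ∫⁻ c in innerSet D j, jensenSum f c (meshRadius j)

lemma approxCount_le {f : ℂ → ℂ} (hf : AnalyticOnNhd ℂ f (ball 0 1)) (h0 : f 0 ≠ 0) {D : Set ℂ}
    (hD : D ⊆ ball 0 1) (j : ℕ) : approxCount f D j ≤ zeroCount f D :=
  lintegral_jensenSum_le hf (mem_ball_self one_pos) h0 (meshRadius_pos j)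
    (measurableSet_innerSet D j)
    (fun _ hc => ball_subset_closedBall.trans (closedBall_subset_of_mem_innerSet hc)) hD

variable {D : Set ℂ}

lemma aemeasurable_approxCount (h : IsGAF P F K) (hD : D ⊆ ball 0 1) (j : ℕ) :
    AEMeasurable (fun ω => approxCount (F ω) D j) P :=
  (h.aemeasurable_setLIntegral_jensenSum (meshRadius_pos j) (measurableSet_innerSet D j)
    (fun _ hc => (closedBall_subset_of_mem_innerSet hc).trans hD)).const_mul _

lemma lintegral_approxCount [IsProbabilityMeasure P] (h : IsGAF P F K) (hD : D ⊆ ball 0 1) (j : ℕ) :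
    ∫⁻ ω, approxCount (F ω) D j ∂P = (logMass (meshRadius j))⁻¹ *
      ∫⁻ c in innerSet D j, ENNReal.ofReal (jensenDensity K c (meshRadius j)) := by
  have hc : ∀ c ∈ innerSet D j, closedBall c (meshRadius j) ⊆ ball 0 1 :=
    fun _ hc => (closedBall_subset_of_mem_innerSet hc).trans hD
  unfold approxCount
  rw [lintegral_const_mul'' _ (h.aemeasurable_setLIntegral_jensenSum (meshRadius_pos j)
    (measurableSet_innerSet D j) hc), h.lintegral_setLIntegral_jensenSum (meshRadius_pos j)
    (measurableSet_innerSet D j) hc]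

/-- Almost surely the count is the liminf of its approximants: each lies below it, and the liminf
lies above it. -/
lemma aemeasurable_zeroCount (h : IsGAF P F K) (hDo : IsOpen D) (hD : D ⊆ ball 0 1) :
    AEMeasurable (fun ω => zeroCount (F ω) D) P := by
  have hm : AEMeasurable
      (fun ω => Filter.liminf (fun j => approxCount (F ω) D j) Filter.atTop) P := by
    refine ⟨_, Measurable.liminf fun j => (h.aemeasurable_approxCount hD j).measurable_mk, ?_⟩
    filter_upwards [ae_all_iff.mpr fun j => (h.aemeasurable_approxCount hD j).ae_eq_mk] with ω hω
    simp_rw [hω]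
  refine hm.congr ?_
  filter_upwards [h.ae_good] with ω ⟨h1, h2⟩
  refine le_antisymm ?_ (zeroCount_le_liminf h1 (mem_ball_self one_pos) h2 hDo hD)
  refine (Filter.liminf_le_liminf (Filter.Eventually.of_forall fun j =>
    approxCount_le h1 h2 hD j)).trans ?_
  simp

variable [IsProbabilityMeasure P]

/-- Zero counts are compared by comparing the Jensen densities of the covariance kernels. -/
theorem lintegral_zeroCount_le (h : IsGAF P F K) {Ω' : Type*} [MeasurableSpace Ω']
    {P' : Measure Ω'} [IsProbabilityMeasure P'] {F' : Ω' → ℂ → ℂ} {K' : ℂ → ℝ}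
    (h' : IsGAF P' F' K') (hDo : IsOpen D) (hD : D ⊆ ball 0 1)
    (hle : ∀ (c : ℂ) (R : ℝ), 0 < R → closedBall c R ⊆ ball 0 1 →
      jensenDensity K c R ≤ jensenDensity K' c R) :
    ∫⁻ ω, zeroCount (F ω) D ∂P ≤ ∫⁻ ω, zeroCount (F' ω) D ∂P' := by
  -- Fatou is used only for `F`. For `F'` the bound `approxCount_le` at each fixed mesh is enough,
  -- so no limit is exchanged on that side.
  calc ∫⁻ ω, zeroCount (F ω) D ∂P
      ≤ ∫⁻ ω, Filter.liminf (fun j => approxCount (F ω) D j) Filter.atTop ∂P := by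
        refine lintegral_mono_ae ?_
        filter_upwards [h.ae_good] with ω ⟨h1, h2⟩
        exact zeroCount_le_liminf h1 (mem_ball_self one_pos) h2 hDo hD
    _ ≤ Filter.liminf (fun j => ∫⁻ ω, approxCount (F ω) D j ∂P) Filter.atTop :=
        lintegral_liminf_le' fun j => h.aemeasurable_approxCount hD j
    _ ≤ Filter.liminf (fun _ : ℕ => ∫⁻ ω, zeroCount (F' ω) D ∂P') Filter.atTop := by
        refine Filter.liminf_le_liminf (Filter.Eventually.of_forall fun j => ?_)
        calc ∫⁻ ω, approxCount (F ω) D j ∂P ≤ ∫⁻ ω, approxCount (F' ω) D j ∂P' := by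
              rw [h.lintegral_approxCount hD, h'.lintegral_approxCount hD]
              refine mul_le_mul_right ?_ _
              refine setLIntegral_mono' (measurableSet_innerSet D j) fun c hc => ?_
              exact ENNReal.ofReal_le_ofReal (hle c _ (meshRadius_pos j)
                ((closedBall_subset_of_mem_innerSet hc).trans hD))
          _ ≤ ∫⁻ ω, zeroCount (F' ω) D ∂P' := by
              refine lintegral_mono_ae ?_
              filter_upwards [h'.ae_good] with ω ⟨h1, h2⟩
              exact approxCount_le h1 h2 hD j
    _ = ∫⁻ ω, zeroCount (F' ω) D ∂P' := by simp

end Average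

end IsGAF

/-! ### Zero counts as set functions -/

lemma zeroCount_mono (f : ℂ → ℂ) {A B : Set ℂ} (h : A ⊆ B) : zeroCount f A ≤ zeroCount f B :=
  ENNReal.tsum_mono_subtype (fun z => ((analyticOrderAt f z : ℕ∞) : ℝ≥0∞)) h

lemma zeroCount_le_add (f : ℂ → ℂ) {A B D : Set ℂ} (h : D ⊆ A ∪ B) :
    zeroCount f D ≤ zeroCount f A + zeroCount f B :=
  (zeroCount_mono f h).trans
    (ENNReal.tsum_union_le (fun z => ((analyticOrderAt f z : ℕ∞) : ℝ≥0∞)) A B)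

lemma zeroCount_add_le (f : ℂ → ℂ) {A B D : Set ℂ} (hd : Disjoint A B) (h : A ∪ B ⊆ D) :
    zeroCount f A + zeroCount f B ≤ zeroCount f D := by
  refine le_trans (le_of_eq ?_) (zeroCount_mono f h)
  exact (ENNReal.summable.tsum_union_disjoint
    (f := fun z => ((analyticOrderAt f z : ℕ∞) : ℝ≥0∞)) hd ENNReal.summable).symm

/-- Upper Riemann sum of step `ε` for the layer-cake identity `L⁺ = ∫ 1_{0 ≤ a < L} da`; the next
lemma is the lower sum, with sample points shifted by one step. -/
lemma ofReal_le_tsum_steps (L : ℝ) {ε : ℝ} (hε : 0 < ε) :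
    ENNReal.ofReal L ≤ ∑' k : ℕ, ENNReal.ofReal ε * (if (k : ℝ) * ε < L then 1 else 0) := by
  calc ENNReal.ofReal L ≤ ∑ k ∈ Finset.range ⌈L / ε⌉₊, ENNReal.ofReal ε := by
        rw [Finset.sum_const, Finset.card_range, nsmul_eq_mul, ← ENNReal.ofReal_natCast,
          ← ENNReal.ofReal_mul (by positivity)]
        apply ENNReal.ofReal_le_ofReal
        rw [← div_le_iff₀ hε]
        exact Nat.le_ceil _
    _ = ∑ k ∈ Finset.range ⌈L / ε⌉₊,
          ENNReal.ofReal ε * (if (k : ℝ) * ε < L then 1 else 0) := by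
        refine Finset.sum_congr rfl fun k hk => ?_
        rw [Finset.mem_range, Nat.lt_ceil, lt_div_iff₀ hε] at hk
        rw [if_pos hk, mul_one]
    _ ≤ _ := ENNReal.sum_le_tsum _

lemma tsum_steps_le_ofReal (L : ℝ) {ε : ℝ} (hε : 0 < ε) :
    ∑' k : ℕ, ENNReal.ofReal ε * (if ((k : ℝ) + 1) * ε < L then 1 else 0) ≤ ENNReal.ofReal L := by
  have hle : ∀ k : ℕ, ((k : ℝ) + 1) * ε < L → k ∈ Finset.range ⌊L / ε⌋₊ := by
    intro k hk
    rw [Finset.mem_range, ← Nat.succ_le_iff]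
    apply Nat.le_floor
    rw [le_div_iff₀ hε]
    push_cast
    exact hk.le
  rw [tsum_eq_sum (s := Finset.range ⌊L / ε⌋₊) (fun k hk => by
    rw [if_neg (fun h => hk (hle k h)), mul_zero])]
  calc _ ≤ ∑ k ∈ Finset.range ⌊L / ε⌋₊, ENNReal.ofReal ε := by
        refine Finset.sum_le_sum fun k _ => ?_
        split_ifs <;> simp
    _ ≤ ENNReal.ofReal L := by
        rw [Finset.sum_const, Finset.card_range, nsmul_eq_mul, ← ENNReal.ofReal_natCast,
          ← ENNReal.ofReal_mul (by positivity)]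
        rcases le_total L 0 with h | h
        · rw [Nat.floor_of_nonpos (div_nonpos_of_nonpos_of_nonneg h hε.le)]
          simp
        · apply ENNReal.ofReal_le_ofReal
          rw [← le_div_iff₀ hε]
          exact Nat.floor_le (by positivity)

lemma mem_ball_exp_iff {c u : ℂ} (hne : u ≠ c) {R : ℝ} (hR : 0 < R) (a : ℝ) :
    a < Real.log (R * ‖c - u‖⁻¹) ↔ u ∈ ball c (R * Real.exp (-a)) := by
  have hpos : 0 < ‖c - u‖ := norm_pos_iff.mpr (sub_ne_zero.mpr hne.symm)
  rw [Real.lt_log_iff_exp_lt (by positivity), mem_ball, dist_eq_norm, norm_sub_rev u c,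
    ← div_eq_mul_inv, lt_div_iff₀ hpos, Real.exp_neg, ← div_eq_mul_inv,
    lt_div_iff₀ (Real.exp_pos a), mul_comm]

lemma zeroCount_ball_eq {f : ℂ → ℂ} {c : ℂ} {r : ℝ} (h : ball c r ⊆ ball 0 1) :
    zeroCount f (ball c r) = ∑' u : ball (0 : ℂ) 1, ((analyticOrderAt f (u : ℂ) : ℕ∞) : ℝ≥0∞) *
      (ball c r).indicator (fun _ => 1) (u : ℂ) := by
  rw [zeroCount, tsum_subtype (ball c r) (fun u => ((analyticOrderAt f u : ℕ∞) : ℝ≥0∞)),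
    tsum_subtype (ball (0 : ℂ) 1) (fun u => ((analyticOrderAt f u : ℕ∞) : ℝ≥0∞) *
      (ball c r).indicator (fun _ => 1) u)]
  refine tsum_congr fun u => ?_
  by_cases hu : u ∈ ball c r
  · simp only [Set.indicator_of_mem hu, Set.indicator_of_mem (h hu), mul_one]
  · classical
    rw [Set.indicator_of_notMem hu, Set.indicator_apply, Set.indicator_of_notMem hu, mul_zero,
      ite_self]

lemma indicator_ball_eq {c u : ℂ} (hne : u ≠ c) {R : ℝ} (hR : 0 < R) (a : ℝ) :
    (if a < Real.log (R * ‖c - u‖⁻¹) then (1 : ℝ≥0∞) else 0) =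
      (ball c (R * Real.exp (-a))).indicator (fun _ => 1) u := by
  classical
  rw [Set.indicator_apply]
  exact if_congr (mem_ball_exp_iff hne hR a) rfl rfl

lemma ball_exp_subset {c : ℂ} {R a : ℝ} (hR : 0 < R) (ha : 0 ≤ a) :
    ball c (R * Real.exp (-a)) ⊆ ball c R := by
  apply ball_subset_ball
  have : Real.exp (-a) ≤ 1 := Real.exp_le_one_iff.mpr (by linarith)
  nlinarith

/-- Layer cake in the logarithm of the radius: the weight of `u` exceeds `a` exactly when `u` lies
in the disk of radius `R exp (-a)`. The centre is an exception, removed by `f c ≠ 0`. -/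
lemma jensenSum_le_tsum {f : ℂ → ℂ} (hf : AnalyticOnNhd ℂ f (ball 0 1)) {c : ℂ} {R ε : ℝ}
    (hR : 0 < R) (hε : 0 < ε) (hc : ball c R ⊆ ball 0 1) (h0 : f c ≠ 0) :
    jensenSum f c R ≤ ∑' k : ℕ, ENNReal.ofReal ε *
      zeroCount f (ball c (R * Real.exp (-((k : ℝ) * ε)))) := by
  have hz : ∀ k : ℕ, zeroCount f (ball c (R * Real.exp (-((k : ℝ) * ε)))) = _ := fun k =>
    zeroCount_ball_eq (f := f) ((ball_exp_subset hR (by positivity)).trans hc)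
  simp_rw [hz, ← ENNReal.tsum_mul_left]
  rw [ENNReal.tsum_comm, jensenSum]
  refine ENNReal.tsum_le_tsum fun u => ?_
  rcases eq_or_ne (u : ℂ) c with hu | hne
  · rw [(hf u u.2).analyticOrderAt_eq_zero.mpr (by rwa [hu])]
    simp
  · refine (mul_le_mul_right (ofReal_le_tsum_steps _ hε) _).trans_eq ?_
    rw [← ENNReal.tsum_mul_left]
    exact tsum_congr fun k => by rw [indicator_ball_eq hne hR, mul_left_comm]

lemma tsum_le_jensenSum {f : ℂ → ℂ} (hf : AnalyticOnNhd ℂ f (ball 0 1)) {c : ℂ} {R ε : ℝ}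
    (hR : 0 < R) (hε : 0 < ε) (hc : ball c R ⊆ ball 0 1) (h0 : f c ≠ 0) :
    ∑' k : ℕ, ENNReal.ofReal ε *
      zeroCount f (ball c (R * Real.exp (-(((k : ℝ) + 1) * ε)))) ≤ jensenSum f c R := by
  have hz : ∀ k : ℕ, zeroCount f (ball c (R * Real.exp (-(((k : ℝ) + 1) * ε)))) = _ := fun k =>
    zeroCount_ball_eq (f := f) ((ball_exp_subset hR (by positivity)).trans hc)
  simp_rw [hz, ← ENNReal.tsum_mul_left]
  rw [ENNReal.tsum_comm, jensenSum]
  refine ENNReal.tsum_le_tsum fun u => ?_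
  rcases eq_or_ne (u : ℂ) c with hu | hne
  · rw [(hf u u.2).analyticOrderAt_eq_zero.mpr (by rwa [hu])]
    simp
  · refine le_of_eq_of_le ?_ (mul_le_mul_right (tsum_steps_le_ofReal _ hε) _)
    rw [← ENNReal.tsum_mul_left]
    exact tsum_congr fun k => by rw [indicator_ball_eq hne hR, mul_left_comm]

/-! ### The equality case -/

namespace IsGAF

variable {Ω : Type*} [MeasurableSpace Ω] {P : Measure Ω}
  {F : Ω → ℂ → ℂ} {K : ℂ → ℝ}

/-- `D` sits in a disk of radius `r < R < 1`, and each zero there adds at least `log (R / r)` to the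
Jensen sum about `0`, whose expectation is finite. -/
lemma lintegral_zeroCount_ne_top [IsProbabilityMeasure P] (h : IsGAF P F K) {D : Set ℂ} (hD : closure D ⊆ ball 0 1) :
    ∫⁻ ω, zeroCount (F ω) D ∂P ≠ ⊤ := by
  obtain ⟨r₀, hr₀, hsub⟩ := exists_lt_subset_ball isClosed_closure hD
  -- The maximum with `1 / 2` only ensures that the radius is positive.
  set r := max r₀ (1 / 2) with hr
  have hrpos : 0 < r := by positivity
  have hr1 : r < 1 := max_lt hr₀ (by norm_num)
  set R := (1 + r) / 2 with hRdef
  have hRpos : 0 < R := by positivity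
  have hrR : r < R := by rw [hRdef]; linarith
  have hR1 : R < 1 := by rw [hRdef]; linarith
  -- Chosen so that the term `k = 0` of the lower Riemann sum counts zeros in exactly the disk of
  -- radius `r`.
  set ε := Real.log (R / r) with hεdef
  have hε : 0 < ε := Real.log_pos ((one_lt_div hrpos).mpr hrR)
  have hexp : R * Real.exp (-(((0 : ℕ) : ℝ) + 1) * ε) = r := by
    rw [Nat.cast_zero, zero_add, neg_mul, one_mul, Real.exp_neg, hεdef,
      Real.exp_log (by positivity)]
    field_simp
  have hcb : closedBall (0 : ℂ) R ⊆ ball 0 1 := closedBall_subset_ball hR1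
  have hle : ENNReal.ofReal ε * ∫⁻ ω, zeroCount (F ω) D ∂P ≤
      ENNReal.ofReal (jensenDensity K 0 R) := by
    rw [← h.lintegral_jensenSum hRpos hcb, ← lintegral_const_mul' _ _ ENNReal.ofReal_ne_top]
    refine lintegral_mono_ae ?_
    filter_upwards [h.ae_good] with ω ⟨h1, h2⟩
    refine le_trans ?_ (tsum_le_jensenSum h1 hRpos hε (ball_subset_closedBall.trans hcb) h2)
    refine le_trans ?_ (ENNReal.le_tsum 0)
    rw [← neg_mul, hexp]
    gcongr
    exact zeroCount_mono _
      ((subset_closure.trans hsub).trans (ball_subset_ball (le_max_left _ _)))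
  intro htop
  rw [htop, ENNReal.mul_top (by simpa using hε)] at hle
  exact absurd (top_le_iff.mp hle) ENNReal.ofReal_ne_top

variable {Ω' : Type*} [MeasurableSpace Ω'] {P' : Measure Ω'}
  {F' : Ω' → ℂ → ℂ} {K' : ℂ → ℝ}

/-- If the zero counts of a dominated field have the same expectation in `D`, they dominate on
smaller disks, up to an arbitrarily small increase of the radius. -/
lemma lintegral_zeroCount_ball_le (h : IsGAF P F K) (h' : IsGAF P' F' K') {D : Set ℂ}
    (hDo : IsOpen D) (hD : D ⊆ ball 0 1)
    (hle : ∀ E : Set ℂ, IsOpen E → E ⊆ ball 0 1 →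
      ∫⁻ ω, zeroCount (F ω) E ∂P ≤ ∫⁻ ω, zeroCount (F' ω) E ∂P')
    (heq : ∫⁻ ω, zeroCount (F' ω) D ∂P' ≤ ∫⁻ ω, zeroCount (F ω) D ∂P)
    (hfin : ∫⁻ ω, zeroCount (F' ω) D ∂P' ≠ ⊤) {c : ℂ} {s t : ℝ} (hst : s < t)
    (ht : ball c t ⊆ D) :
    ∫⁻ ω, zeroCount (F' ω) (ball c s) ∂P' ≤ ∫⁻ ω, zeroCount (F ω) (ball c t) ∂P := by
  -- For `F'` the open shell and the smaller disk are disjoint in `D`; for `F` the shell and the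
  -- larger disk cover `D`, including the circle of radius `s`. The finite count of `F'` on the
  -- shell then cancels.
  set E := D \ closedBall c s with hE
  have hEo : IsOpen E := hDo.sdiff isClosed_closedBall
  have hED : E ⊆ D := Set.sdiff_subset
  have hsD : ball c s ⊆ D := (ball_subset_ball hst.le).trans ht
  have hEfin : ∫⁻ ω, zeroCount (F' ω) E ∂P' ≠ ⊤ :=
    ne_top_of_le_ne_top hfin (lintegral_mono fun ω => zeroCount_mono _ hED)
  refine (ENNReal.add_le_add_iff_right hEfin).mp ?_
  calc ∫⁻ ω, zeroCount (F' ω) (ball c s) ∂P' + ∫⁻ ω, zeroCount (F' ω) E ∂P'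
      = ∫⁻ ω, (zeroCount (F' ω) (ball c s) + zeroCount (F' ω) E) ∂P' :=
        (lintegral_add_left' (h'.aemeasurable_zeroCount isOpen_ball (hsD.trans hD)) _).symm
    _ ≤ ∫⁻ ω, zeroCount (F' ω) D ∂P' := by
        refine lintegral_mono fun ω => zeroCount_add_le _ ?_ (Set.union_subset hsD hED)
        exact Set.disjoint_left.mpr fun x hx hxE => hxE.2 (ball_subset_closedBall hx)
    _ ≤ ∫⁻ ω, zeroCount (F ω) D ∂P := heq
    _ ≤ ∫⁻ ω, (zeroCount (F ω) (ball c t) + zeroCount (F ω) E) ∂P := by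
        refine lintegral_mono fun ω => zeroCount_le_add _ fun x hx => ?_
        by_cases hxt : x ∈ closedBall c s
        · exact Or.inl (closedBall_subset_ball hst hxt)
        · exact Or.inr ⟨hx, hxt⟩
    _ = ∫⁻ ω, zeroCount (F ω) (ball c t) ∂P + ∫⁻ ω, zeroCount (F ω) E ∂P :=
        lintegral_add_left' (h.aemeasurable_zeroCount isOpen_ball (ht.trans hD)) _
    _ ≤ ∫⁻ ω, zeroCount (F ω) (ball c t) ∂P + ∫⁻ ω, zeroCount (F' ω) E ∂P' := by
        gcongr
        exact hle E hEo (hED.trans hD)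

variable [IsProbabilityMeasure P]

lemma jensenDensity_le_tsum (h : IsGAF P F K) {c : ℂ} {R ε : ℝ} (hR : 0 < R) (hε : 0 < ε)
    (hc : closedBall c R ⊆ ball 0 1) :
    ENNReal.ofReal (jensenDensity K c R) ≤ ∑' k : ℕ, ENNReal.ofReal ε *
      ∫⁻ ω, zeroCount (F ω) (ball c (R * Real.exp (-((k : ℝ) * ε)))) ∂P := by
  have hb : ball c R ⊆ ball 0 1 := ball_subset_closedBall.trans hc
  have hmeas : ∀ k : ℕ, AEMeasurable
      (fun ω => zeroCount (F ω) (ball c (R * Real.exp (-((k : ℝ) * ε))))) P := fun k =>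
    h.aemeasurable_zeroCount isOpen_ball ((ball_exp_subset hR (by positivity)).trans hb)
  rw [← tsum_congr fun k => lintegral_const_mul'' (ENNReal.ofReal ε) (hmeas k),
    ← lintegral_tsum fun k => (hmeas k).const_mul _, ← h.lintegral_jensenSum hR hc]
  refine lintegral_mono_ae ?_
  filter_upwards [h.analytic, h.ae_ne_zero (hc (mem_closedBall_self hR.le))] with ω h1 h2
  exact jensenSum_le_tsum h1 hR hε hb h2

lemma tsum_le_jensenDensity (h : IsGAF P F K) {c : ℂ} {R ε : ℝ} (hR : 0 < R) (hε : 0 < ε)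
    (hc : closedBall c R ⊆ ball 0 1) :
    ∑' k : ℕ, ENNReal.ofReal ε *
      ∫⁻ ω, zeroCount (F ω) (ball c (R * Real.exp (-(((k : ℝ) + 1) * ε)))) ∂P ≤
      ENNReal.ofReal (jensenDensity K c R) := by
  have hb : ball c R ⊆ ball 0 1 := ball_subset_closedBall.trans hc
  have hmeas : ∀ k : ℕ, AEMeasurable
      (fun ω => zeroCount (F ω) (ball c (R * Real.exp (-(((k : ℝ) + 1) * ε))))) P := fun k =>
    h.aemeasurable_zeroCount isOpen_ball ((ball_exp_subset hR (by positivity)).trans hb)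
  rw [← tsum_congr fun k => lintegral_const_mul'' (ENNReal.ofReal ε) (hmeas k),
    ← lintegral_tsum fun k => (hmeas k).const_mul _, ← h.lintegral_jensenSum hR hc]
  refine lintegral_mono_ae ?_
  filter_upwards [h.analytic, h.ae_ne_zero (hc (mem_closedBall_self hR.le))] with ω h1 h2
  exact tsum_le_jensenSum h1 hR hε hb h2

/-- The upper Riemann sum for `K'` is compared with disk counts of `F` one step larger. From the
third term on, these form the lower Riemann sum for `K`; the first two terms cost at most `2 ε M`,
which vanishes as `ε → 0` because `M` is finite. -/
lemma jensenDensity_le_of_lintegral_zeroCount_eq [IsProbabilityMeasure P']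
    (h : IsGAF P F K) (h' : IsGAF P' F' K')
    {D : Set ℂ} (hDo : IsOpen D) (hD : D ⊆ ball 0 1)
    (hle : ∀ E : Set ℂ, IsOpen E → E ⊆ ball 0 1 →
      ∫⁻ ω, zeroCount (F ω) E ∂P ≤ ∫⁻ ω, zeroCount (F' ω) E ∂P')
    (heq : ∫⁻ ω, zeroCount (F' ω) D ∂P' ≤ ∫⁻ ω, zeroCount (F ω) D ∂P)
    (hfin : ∫⁻ ω, zeroCount (F' ω) D ∂P' ≠ ⊤) {c : ℂ} {R R' : ℝ} (hR : 0 < R) (hRR' : R < R')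
    (hRD : ball c R' ⊆ D) : jensenDensity K' c R ≤ jensenDensity K c R := by
  have hcR : closedBall c R ⊆ ball 0 1 := (closedBall_subset_ball hRR').trans (hRD.trans hD)
  have hcD : ball c R ⊆ D := (ball_subset_ball hRR'.le).trans hRD
  set M := ∫⁻ ω, zeroCount (F' ω) D ∂P' with hM
  -- For `ε < δ` the largest enlarged disk, of radius `R exp ε`, still lies in `ball c R'`.
  set δ := Real.log (R' / R) with hδ
  have hδpos : 0 < δ := Real.log_pos ((one_lt_div hR).mpr hRR')
  have hexpδ : R * Real.exp δ = R' := by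
    rw [hδ, Real.exp_log (div_pos (hR.trans hRR') hR)]
    field_simp
  have hshell : ∀ E ⊆ D, IsOpen E → ∫⁻ ω, zeroCount (F ω) E ∂P ≤ M := fun E hE hEo =>
    (hle E hEo (hE.trans hD)).trans (lintegral_mono fun ω => zeroCount_mono _ hE)
  have key : ∀ ε, 0 < ε → ε < δ → ENNReal.ofReal (jensenDensity K' c R) ≤
      ENNReal.ofReal ε * (2 * M) + ENNReal.ofReal (jensenDensity K c R) := by
    intro ε hε hεδ
    have hbig : ball c (R * Real.exp ε) ⊆ D := by
      refine (ball_subset_ball ?_).trans hRD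
      rw [← hexpδ]
      gcongr
    let e : ℕ → ℝ≥0∞ := fun k => ENNReal.ofReal ε *
      ∫⁻ ω, zeroCount (F ω) (ball c (R * Real.exp (-(((k : ℝ) - 1) * ε)))) ∂P
    have hstep : ∀ k : ℕ, ENNReal.ofReal ε *
        ∫⁻ ω, zeroCount (F' ω) (ball c (R * Real.exp (-((k : ℝ) * ε)))) ∂P' ≤ e k := by
      intro k
      refine mul_le_mul_right (h.lintegral_zeroCount_ball_le h' hDo hD hle heq hfin ?_ ?_) _
      · gcongr
        linarith
      · refine (ball_subset_ball ?_).trans hbig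
        have : (0 : ℝ) ≤ k := Nat.cast_nonneg k
        gcongr
        nlinarith
    have htail : ∑' k, e (k + 2) ≤ ENNReal.ofReal (jensenDensity K c R) := by
      refine le_of_eq_of_le (tsum_congr fun k => ?_) (h.tsum_le_jensenDensity hR hε hcR)
      have : (((k + 2 : ℕ) : ℝ) - 1) = (k : ℝ) + 1 := by push_cast; ring
      simp only [e, this]
    have hhead : e 0 + e 1 ≤ ENNReal.ofReal ε * (2 * M) := by
      rw [two_mul, mul_add]
      refine add_le_add (mul_le_mul_right (hshell _ ?_ isOpen_ball) _)
        (mul_le_mul_right (hshell _ ?_ isOpen_ball) _)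
      · simpa using hbig
      · simpa using hcD
    have hsplit : ∑' k, e k = e 0 + e 1 + ∑' k, e (k + 2) := by
      rw [← Summable.sum_add_tsum_nat_add' (f := e) (k := 2) ENNReal.summable,
        Finset.sum_range_succ, Finset.sum_range_one]
    exact (h'.jensenDensity_le_tsum hR hε hcR).trans <| (ENNReal.tsum_le_tsum hstep).trans <|
      hsplit.le.trans (add_le_add hhead htail)
  have hlim : Filter.Tendsto (fun ε : ℝ => ENNReal.ofReal ε * (2 * M) +
      ENNReal.ofReal (jensenDensity K c R)) (𝓝[>] 0)
      (𝓝 (ENNReal.ofReal (jensenDensity K c R))) := by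
    have h1 : Filter.Tendsto (fun ε : ℝ => ENNReal.ofReal ε) (𝓝[>] 0) (𝓝 0) := by
      have := (ENNReal.continuous_ofReal.tendsto 0).mono_left
        (nhdsWithin_le_nhds (s := Set.Ioi (0 : ℝ)))
      simpa using this
    have h2 := ENNReal.Tendsto.mul_const (b := 2 * M) h1
      (Or.inr (ENNReal.mul_ne_top (by norm_num) hfin))
    simpa using h2.add_const (ENNReal.ofReal (jensenDensity K c R))
  have hfinal : ENNReal.ofReal (jensenDensity K' c R) ≤ ENNReal.ofReal (jensenDensity K c R) := by
    refine ge_of_tendsto hlim ?_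
    filter_upwards [Ioo_mem_nhdsGT hδpos] with ε hε
    exact key ε hε.1 hε.2
  exact (ENNReal.ofReal_le_ofReal_iff (h.jensenDensity_nonneg hR hcR)).mp hfinal

end IsGAF

/-! ### Comparison of stationary covariances with white noise -/

/-- Since `log K` is `log (Re H)` plus its white-noise counterpart, the densities differ by half the
defect in Jensen's inequality. -/
lemma IsStationaryCov.jensenDensity_covKernel {γ : ℤ → ℂ} (h : IsStationaryCov γ) {c : ℂ} {R : ℝ}
    (hR : 0 < R) (hc : closedBall c R ⊆ ball 0 1) :
    jensenDensity (covKernel γ) c R = jensenDensity (covKernel whiteCov) c R -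
      (1 / 2) * (Real.log (herglotz γ c).re -
        Real.circleAverage (fun z => Real.log (herglotz γ z).re) c R) := by
  have hlog : ∀ z ∈ ball (0 : ℂ) 1, Real.log (covKernel γ z) =
      Real.log (herglotz γ z).re + Real.log (covKernel whiteCov z) := by
    intro z hz
    have hp := IsStationaryCov.one_sub_norm_sq_pos (mem_ball_zero_iff.mp hz)
    rw [← Real.log_mul (h.re_herglotz_pos hz).ne' (isStationaryCov_whiteCov.covKernel_pos hz).ne',
      covKernel, covKernel, herglotz_whiteCov, Complex.one_re, mul_one_div]
  have hsub : sphere c R ⊆ ball 0 1 := sphere_subset_closedBall.trans hc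
  have hi1 : CircleIntegrable (fun z => Real.log (herglotz γ z).re) c R :=
    (h.continuousOn_log_re hc).circleIntegrable hR.le
  have hi2 : CircleIntegrable (fun z => Real.log (covKernel whiteCov z)) c R :=
    ((isStationaryCov_whiteCov.continuousOn_covKernel.mono hsub).log fun z hz =>
      (isStationaryCov_whiteCov.covKernel_pos (hsub hz)).ne').circleIntegrable hR.le
  have hav : Real.circleAverage (fun z => Real.log (covKernel γ z)) c R =
      Real.circleAverage (fun z => Real.log (herglotz γ z).re) c R +
        Real.circleAverage (fun z => Real.log (covKernel whiteCov z)) c R := by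
    rw [← Real.circleAverage_add hi1 hi2]
    refine Real.circleAverage_congr_sphere fun z hz => ?_
    rw [abs_of_pos hR] at hz
    exact hlog z (hsub hz)
  rw [jensenDensity, jensenDensity, hav, hlog c (hc (mem_closedBall_self hR.le))]
  ring

lemma isSmoothDomain_ball_half : IsSmoothDomain (ball (0 : ℂ) (1 / 2)) where
  isOpen := isOpen_ball
  isConnected := ⟨nonempty_ball.mpr (by norm_num), (convex_ball 0 _).isPreconnected⟩
  smooth_boundary p hp := by
    rw [frontier_ball (0 : ℂ) (by norm_num), mem_sphere_zero_iff_norm] at hp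
    refine ⟨fun z => ‖z‖ ^ 2 - 1 / 4, (contDiff_norm_sq ℝ).sub contDiff_const, ?_, ?_⟩
    · have h1 : HasFDerivAt (fun z : ℂ => ‖z‖ ^ 2 - 1 / 4) (2 • (innerSL ℝ) p) p :=
        (hasStrictFDerivAt_norm_sq p).hasFDerivAt.sub_const _
      rw [h1.fderiv]
      intro h0
      have := congrArg (fun L : ℂ →L[ℝ] ℝ => L p) h0
      simp [hp] at this
    · refine Filter.Eventually.of_forall fun z => ?_
      rw [mem_ball_zero_iff]
      constructor
      · intro h; nlinarith [norm_nonneg z]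
      · intro h; nlinarith [norm_nonneg z]

section

variable {Ω Ω' : Type*} [MeasurableSpace Ω] [MeasurableSpace Ω'] {P : Measure Ω}
  [IsProbabilityMeasure P] {P' : Measure Ω'} [IsProbabilityMeasure P'] {γ : ℤ → ℂ}
  {ξ : ℕ → Ω → ℂ} {ζ : ℕ → Ω' → ℂ}

namespace GaussianCoeffs

/-- The random power series agrees almost surely with a jointly measurable one. -/
lemma exists_isGAF (h : GaussianCoeffs P γ ξ) :
    ∃ F : Ω → ℂ → ℂ, IsGAF P F (covKernel γ) ∧
      ∀ D, expectedZeros P ξ D = ∫⁻ ω, zeroCount (F ω) D ∂P := by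
  have hae := fun k => (h.aemeasurable k).ae_eq_mk
  refine ⟨_, (h.congr hae).isGAF fun k => (h.aemeasurable k).measurable_mk, fun D => ?_⟩
  refine lintegral_congr_ae ?_
  filter_upwards [ae_all_iff.mpr hae] with ω hω
  have : randomPowerSeries ξ ω =
      randomPowerSeries (fun k => (h.aemeasurable k).mk (ξ k)) ω := by
    funext z
    simp only [randomPowerSeries, hω]
  rw [this]

lemma expectedZeros_le_white (h : GaussianCoeffs P γ ξ) (h' : GaussianCoeffs P' whiteCov ζ)
    {D : Set ℂ} (hDo : IsOpen D) (hD : D ⊆ ball 0 1) :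
    expectedZeros P ξ D ≤ expectedZeros P' ζ D := by
  obtain ⟨F, hF, hE⟩ := h.exists_isGAF
  obtain ⟨F', hF', hE'⟩ := h'.exists_isGAF
  rw [hE, hE']
  refine hF.lintegral_zeroCount_le hF' hDo hD fun c R hR hc => ?_
  rw [h.jensenDensity_covKernel hR hc]
  linarith [h.circleAverage_log_re_le hR hc]

/-- Near a point `c` of `D`, each `z ≠ c` lies on a circle about `c` inside `D`, where equality of
Jensen densities gives `Re H z = Re H c`. -/
lemma eq_whiteCov_of_expectedZeros_eq (h : GaussianCoeffs P γ ξ)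
    (h' : GaussianCoeffs P' whiteCov ζ) {D : Set ℂ} (hDo : IsOpen D) (hne : D.Nonempty)
    (hD : closure D ⊆ ball 0 1) (heq : expectedZeros P ξ D = expectedZeros P' ζ D) :
    γ = whiteCov := by
  have hle := fun E hEo hE => h.expectedZeros_le_white h' (D := E) hEo hE
  obtain ⟨F, hF, hE⟩ := h.exists_isGAF
  obtain ⟨F', hF', hE'⟩ := h'.exists_isGAF
  simp_rw [hE, hE'] at hle heq
  have hD1 := subset_closure.trans hD
  obtain ⟨c, hcD⟩ := hne
  obtain ⟨r, hr, hrD⟩ := Metric.isOpen_iff.mp hDo c hcD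
  refine h.eq_whiteCov (h.herglotz_eq_one_of_locally_const (hD1 hcD) ?_)
  filter_upwards [ball_mem_nhds c hr] with z hz
  rcases eq_or_ne z c with rfl | hzc
  · rfl
  · have hpos : 0 < dist z c := dist_pos.mpr hzc
    have hc : closedBall c (dist z c) ⊆ ball 0 1 :=
      (closedBall_subset_ball hz).trans (hrD.trans hD1)
    have hJ := hF.jensenDensity_le_of_lintegral_zeroCount_eq hF' hDo hD1 hle heq.ge
      (hF'.lintegral_zeroCount_ne_top hD) hpos hz hrD
    rw [h.jensenDensity_covKernel hpos hc] at hJ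
    refine h.re_herglotz_eq_of_circleAverage_eq hpos hc
      (le_antisymm (h.circleAverage_log_re_le hpos hc) (by linarith)) rfl

/-- One-point variances already suffice: equality of the kernels says `Re H = 1` on the disk. -/
lemma eq_whiteCov_of_equalInLaw (h : GaussianCoeffs P γ ξ) (h' : GaussianCoeffs P' whiteCov ζ)
    (heq : EqualInLaw P P' ξ ζ) : γ = whiteCov := by
  have hre : ∀ z ∈ ball (0 : ℂ) 1, (herglotz γ z).re = 1 := by
    intro z hz
    have := h.covKernel_eq_of_equalInLaw h' heq hz
    have hp := (IsStationaryCov.one_sub_norm_sq_pos (mem_ball_zero_iff.mp hz)).ne'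
    rw [covKernel, covKernel, herglotz_whiteCov, Complex.one_re, div_left_inj' hp] at this
    exact this
  have h0 : (0 : ℂ) ∈ ball (0 : ℂ) 1 := mem_ball_self one_pos
  refine h.eq_whiteCov (h.herglotz_eq_one_of_locally_const h0 ?_)
  filter_upwards [isOpen_ball.mem_nhds h0] with z hz
  rw [hre z hz, hre 0 h0]

end GaussianCoeffs

end

end

/-! ### The theorem -/

theorem theorem1p2 {Ω Ω' : Type*} [MeasurableSpace Ω] [MeasurableSpace Ω']
    (P : Measure Ω) [IsProbabilityMeasure P] (P' : Measure Ω') [IsProbabilityMeasure P']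
    (γ : ℤ → ℂ) (ξ : ℕ → Ω → ℂ) (hξ : IsStationaryComplexGaussian P γ ξ)
    (ζ : ℕ → Ω' → ℂ) (hζ : IsIIDStdComplexGaussian P' ζ) :
    (∀ D : Set ℂ, IsSmoothDomain D → D ⊆ ball 0 1 →
      expectedZeros P ξ D ≤ expectedZeros P' ζ D) ∧
    ((∃ D : Set ℂ, IsSmoothDomain D ∧ closure D ⊆ ball 0 1 ∧
      expectedZeros P ξ D = expectedZeros P' ζ D) ↔ EqualInLaw P P' ξ ζ) ∧
    ((∀ D : Set ℂ, IsSmoothDomain D → D ⊆ ball 0 1 →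
      expectedZeros P ξ D = expectedZeros P' ζ D) ↔ EqualInLaw P P' ξ ζ) := by
  have h := hξ.gaussianCoeffs
  have h' := hζ.gaussianCoeffs
  have hhalf : closure (ball (0 : ℂ) (1 / 2)) ⊆ ball 0 1 :=
    closure_ball_subset_closedBall.trans (closedBall_subset_ball (by norm_num))
  have hlaw_all : EqualInLaw P P' ξ ζ → ∀ D : Set ℂ, IsSmoothDomain D → D ⊆ ball 0 1 →
      expectedZeros P ξ D = expectedZeros P' ζ D := by
    intro hlaw D hD hD1
    have hγ := h.eq_whiteCov_of_equalInLaw h' hlaw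
    subst hγ
    -- Both sequences now have white covariance, so the comparison applies in both directions.
    exact le_antisymm (h.expectedZeros_le_white h' hD.isOpen hD1)
      (h'.expectedZeros_le_white h hD.isOpen hD1)
  have hex_law : (∃ D : Set ℂ, IsSmoothDomain D ∧ closure D ⊆ ball 0 1 ∧
      expectedZeros P ξ D = expectedZeros P' ζ D) → EqualInLaw P P' ξ ζ := by
    rintro ⟨D, hD, hD1, heq⟩
    have hγ := h.eq_whiteCov_of_expectedZeros_eq h' hD.isOpen hD.isConnected.nonempty hD1 heq
    subst hγ
    exact h.equalInLaw h'
  have hall_ex : (∀ D : Set ℂ, IsSmoothDomain D → D ⊆ ball 0 1 →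
      expectedZeros P ξ D = expectedZeros P' ζ D) → ∃ D : Set ℂ, IsSmoothDomain D ∧
      closure D ⊆ ball 0 1 ∧ expectedZeros P ξ D = expectedZeros P' ζ D := fun hall =>
    ⟨_, isSmoothDomain_ball_half, hhalf,
      hall _ isSmoothDomain_ball_half (subset_closure.trans hhalf)⟩
  exact ⟨fun D hD hD1 => h.expectedZeros_le_white h' hD.isOpen hD1,
    ⟨hex_law, fun hlaw => hall_ex (hlaw_all hlaw)⟩,
    ⟨fun hall => hex_law (hall_ex hall), hlaw_all⟩⟩
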